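/- Let $G$ be a group, let $V$ be an irreducible finite-dimensional complex linear representation of $G$, and let $X \subseteq V$ be a $G$-invariant affine cone, i.e. a nonempty Zariski closed subset with $\mathbb{C}\cdot X \subseteq X$ and $gX \subseteq X$ for all $g \in G$. Let $X_1,\ldots,X_k$ be the irreducible components of $X$, assume that each $X_i$ is $G$-invariant (this is automatic, for instance, if $G$ is a connected algebraic group acting algebraically), and let $N_{\max} = \max_i \dim X_i$; assume $N_{\max} > 0$, i.e. $X \neq \{0\}$. For subsets $Y_1,\ldots,Y_r$ of $V$, the join $J(Y_1,\ldots,Y_r)$ is the Zariski closure of $\{y_1+\cdots+y_r \mid y_i \in Y_i\}$, and $\sigma_r(X) = J(X,\ldots,X)$ with $r$ copies of $X$. Then, for every integer $r \ge 0$: 1. If $r \le \frac{\dim V}{N_{\max}} - N_{\max}$, then $X$ is $r$-nondefective: for all $i_1,\ldots,i_r \in \{1,\ldots,k\}$ (repetitions allowed), the join $J(X_{i_1},\ldots,X_{i_r})$ has the expected dimension $\min\{\dim X_{i_1}+\cdots+\dim X_{i_r},\ \dim V\}$. 2. If $r \ge \frac{\dim V}{N_{\max}} + N_{\max}$, then $\sigma_r(X)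 = V$. -/

import Mathlib

namespace SecantCones

noncomputable section

variable (V : Type*) [AddCommGroup V] [Module ℂ V]

/-- The algebra `ℂ[V]` of polynomial functions on the complex vector space `V`: the algebra of
functions `V → ℂ` generated by the linear forms. -/
def polyFun : Subalgebra ℂ (V → ℂ) :=
  Algebra.adjoin ℂ (Set.range fun φ : Module.Dual ℂ V => (φ : V → ℂ))

variable {V}

/-- The set of common zeros of a set of polynomial functions. -/
def zeroSet (S : Set (polyFun V)) : Set V :=
  {v | ∀ f ∈ S, (f : V → ℂ) v = 0}

variable (V) in
/-- The Zariski topology on `V`: the closed sets are the common zero sets of sets of polynomial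
functions. -/
@[reducible] def zariskiTopology : TopologicalSpace V :=
  TopologicalSpace.ofClosed {Z : Set V | ∃ S : Set (polyFun V), Z = zeroSet S}
    ⟨{1}, by ext v; simp [zeroSet]⟩
    (fun A hA => by
      refine ⟨{f | ∃ S, zeroSet S ∈ A ∧ f ∈ S}, ?_⟩
      ext v
      constructor
      · rintro hv f ⟨S, hS, hf⟩
        exact hv _ hS f hf
      · intro hv Z hZ
        obtain ⟨S, rfl⟩ := hA hZ
        exact fun f hf => hv f ⟨S, hZ, hf⟩)
    (by
      rintro _ ⟨S, rfl⟩ _ ⟨T, rfl⟩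
      refine ⟨{h | ∃ f ∈ S, ∃ g ∈ T, h = f * g}, ?_⟩
      ext v
      constructor
      · rintro (hv | hv) _ ⟨f, hf, g, hg, rfl⟩
        · simp [hv f hf]
        · simp [hv g hg]
      · intro hv
        by_contra hcon
        simp only [Set.mem_union, zeroSet, Set.mem_ofPred_eq, not_or, not_forall] at hcon
        obtain ⟨⟨f, hf, hfv⟩, g, hg, hgv⟩ := hcon
        have h := hv (f * g) ⟨f, hf, g, hg, rfl⟩
        simp [hfv, hgv] at h)

/-- `Z` is a closed subvariety of `V`. -/
def IsZariskiClosed (Z : Set V) : Prop :=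
  @IsClosed V (zariskiTopology V) Z

/-- The Zariski closure of a subset of `V`. -/
def zariskiClosure (S : Set V) : Set V :=
  @closure V (zariskiTopology V) S

/-- The irreducible components of `X ⊆ V`: the maximal irreducible subsets of `X`. -/
def components (X : Set V) : Set (Set V) :=
  {Z | Maximal (fun Y : Set V => @IsIrreducible V (zariskiTopology V) Y ∧ Y ⊆ X) Z}

/-- The ideal of polynomial functions that vanish on `Z`. -/
def vanishingIdeal (Z : Set V) : Ideal (polyFun V) where
  carrier := {f | ∀ v ∈ Z, (f : V → ℂ) v = 0}
  zero_mem' := fun _ _ => rfl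
  add_mem' := fun {f g} hf hg v hv => by simp [hf v hv, hg v hv]
  smul_mem' := fun c f hf v hv => by simp [hf v hv]

/-- The dimension of a closed subvariety `Z` of `V`: the Krull dimension of its coordinate ring
`ℂ[Z] = ℂ[V] / I(Z)`. -/
def zdim (Z : Set V) : WithBot ℕ∞ :=
  ringKrullDim (polyFun V ⧸ vanishingIdeal Z)

/-- `X` is an affine cone in `V`: a nonempty closed subvariety with `ℂ · X ⊆ X`. -/
structure IsAffineCone (X : Set V) : Prop where
  nonempty : X.Nonempty
  closed : IsZariskiClosed X
  smul_mem : ∀ (c : ℂ), ∀ v ∈ X, c • v ∈ X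

/-- The join `J(Y₁, …, Yᵣ)`: the Zariski closure of the set of all sums `y₁ + ⋯ + yᵣ` with
`yᵢ ∈ Yᵢ`. -/
def join {r : ℕ} (Y : Fin r → Set V) : Set V :=
  zariskiClosure {v | ∃ y : Fin r → V, (∀ i, y i ∈ Y i) ∧ v = ∑ i, y i}

/-- The `r`-th secant variety `σᵣ(X) = J(X, …, X)`. -/
def secant (r : ℕ) (X : Set V) : Set V :=
  join fun _ : Fin r => X

/-- The expected dimension `min {dim Y₁ + ⋯ + dim Yᵣ, dim V}` of the join `J(Y₁, …, Yᵣ)`. -/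
def expectedDim {r : ℕ} (Y : Fin r → Set V) : WithBot ℕ∞ :=
  min (∑ i, zdim (Y i)) ((Module.finrank ℂ V : ℕ) : WithBot ℕ∞)

/-- `X` is `r`-nondefective: every join of `r` irreducible components of `X` (repetitions
allowed) has its expected dimension. -/
def IsNondefective (r : ℕ) (X : Set V) : Prop :=
  ∀ Y : Fin r → Set V, (∀ i, Y i ∈ components X) → zdim (join Y) = expectedDim Y

end

end SecantCones

namespace SecantCones

/-! ### Krull dimension, transcendence bases and derivations. -/

section CommutativeAlgebra

/-! Terracini's lemma turns the statement into linear algebra. The dimension of a join is the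
generic dimension `rk` of a sum of tangent spaces (`rk_spec`). The proof compares derivations of a
coordinate ring with transcendence bases (`zdim_image`), and tangent vectors are values of
polynomial vector fields that preserve the ideal.

For components `Z` and `M i`, let `L` be the sum of the tangent spaces of the `M i` at generic
points and consider the excess `rk₁ Z + rk M - rk (cons Z M)`, the dimension of `T Z ∩ L`. Repeating
an entry of `M` cannot lower it (`rk_submodular`). If no repetition raises it, the points of `M` can
be exchanged one at a time without changing `T Z ∩ L` (`eventually_inf_tangentSum_eq`). If moreover
the excess is positive, the spaces `L` that give this common intersection have a nonzero
intersection, which is stable under the group, so irreducibility forces `L = V` (`rk_eq_finrank`).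

Hence a positive excess grows by at least one with a suitable new entry until `V` is filled. It
never exceeds `dim Z`, so at most `dim Z` new entries suffice (`exists_rk_eq_finrank`). If `r`
entries were dependent while `r ≤ dim V / N - N`, fewer than `r + N` components of dimension at most
`N` would fill `V`, which is too few. Conversely, about `dim V / N` copies of a component of
dimension `N` can be independent, and `N` more copies fill `V`. -/

theorem ringKrullDim_eq_of_isIntegral {R S : Type*} [CommRing R] [CommRing S] [Algebra R S]
    [Algebra.IsIntegral R S] [FaithfulSMul R S] : ringKrullDim S = ringKrullDim R := by
  apply le_antisymm
  · refine Order.krullDim_le_of_strictMono (PrimeSpectrum.comap (algebraMap R S)) ?_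
    intro p q hpq
    exact Ideal.IsIntegral.comap_lt_comap (R := R) (I := p.asIdeal) (J := q.asIdeal) hpq
  · refine iSup_le fun l => ?_
    obtain ⟨Q, -, hQ, hQl⟩ := Ideal.exists_ideal_over_prime_of_isIntegral (S := S)
      l.head.asIdeal (⊥ : Ideal S) (by
        rw [← RingHom.ker, (RingHom.injective_iff_ker_eq_bot _).1
          (FaithfulSMul.algebraMap_injective R S)]
        exact bot_le)
    have : Q.LiesOver l.head.asIdeal := ⟨hQl.symm⟩
    obtain ⟨L, hL, -⟩ := Ideal.exists_ltSeries_of_hasGoingUp l Q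
    rw [← hL]
    exact le_iSup (fun p : LTSeries (PrimeSpectrum S) => (p.length : WithBot ℕ∞)) L

/-- A finite generating family of a domain over a field contains a transcendence basis, whose
cardinality is the Krull dimension. -/
theorem exists_transcendenceBasis_ringKrullDim {k B ι : Type*} [Field k] [CommRing B] [IsDomain B]
    [Algebra k B] [Finite ι] (b : ι → B) (hb : Algebra.adjoin k (Set.range b) = ⊤) :
    ∃ (d : ℕ) (e : Fin d → ι), IsTranscendenceBasis k (b ∘ e) ∧ ringKrullDim B = d := by
  have : Algebra.FiniteType k B := ⟨by
    have := Fintype.ofFinite ι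
    classical
    exact ⟨Finset.univ.image b, by simpa using hb⟩⟩
  -- Noether normalization gives one transcendence basis whose size is the Krull dimension. All
  -- transcendence bases have equal size, so one chosen inside the family `b` has this size too.
  obtain ⟨s, g, hg, hgi⟩ := exists_integral_inj_algHom_of_fg k B
  have hdim : ringKrullDim B = s := by
    let := g.toRingHom.toAlgebra
    have : Algebra.IsIntegral (MvPolynomial (Fin s) k) B := ⟨hgi⟩
    have : FaithfulSMul (MvPolynomial (Fin s) k) B :=
      (faithfulSMul_iff_algebraMap_injective _ _).2 hg
    rw [ringKrullDim_eq_of_isIntegral (R := MvPolynomial (Fin s) k),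
      MvPolynomial.ringKrullDim_of_isNoetherianRing]
    simp
  have htb : IsTranscendenceBasis k (fun i => g (MvPolynomial.X i)) := by
    rw [isTranscendenceBasis_iff_algebraicIndependent_isAlgebraic]
    have hai : AlgebraicIndependent k (fun i => g (MvPolynomial.X i)) := by
      have : MvPolynomial.aeval (fun i => g (MvPolynomial.X i)) = g := by
        ext i; simp
      rw [AlgebraicIndependent, this]
      exact hg
    refine ⟨hai, ⟨fun x => ?_⟩⟩
    obtain ⟨p, hp, hpx⟩ := hgi x
    have hmem : ∀ q, g q ∈ Algebra.adjoin k (Set.range fun i => g (MvPolynomial.X i)) := by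
      intro q
      rw [Algebra.adjoin_range_eq_range_aeval]
      refine ⟨q, ?_⟩
      have : MvPolynomial.aeval (fun i => g (MvPolynomial.X i)) = g := by
        ext i; simp
      exact congrArg (fun f => f q) this
    let g' : MvPolynomial (Fin s) k →ₐ[k]
      Algebra.adjoin k (Set.range fun i => g (MvPolynomial.X i)) := g.codRestrict _ hmem
    refine IsIntegral.isAlgebraic ⟨p.map g'.toRingHom, hp.map _, ?_⟩
    rw [Polynomial.eval₂_map]
    exact hpx
  have : Algebra.IsAlgebraic (Algebra.adjoin k (Set.range b)) B := by
    rw [hb]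
    exact ⟨fun x => isAlgebraic_algebraMap (⟨x, trivial⟩ : (⊤ : Subalgebra k B))⟩
  obtain ⟨t, ht, htb'⟩ := exists_isTranscendenceBasis_subset (R := k) (Set.range b)
  have hfin : Finite t := Set.Finite.subset (Set.finite_range b) ht
  have hcard : Nat.card t = s := by
    have := congrArg Cardinal.toNat (htb.lift_cardinalMk_eq htb')
    simpa [Nat.card] using this.symm
  let eq : Fin s ≃ t := (Finite.equivFinOfCardEq hcard).symm
  choose e he using fun i : Fin s => ht (eq i).2
  refine ⟨s, e, ?_, hdim⟩
  have : b ∘ e = (Subtype.val : t → B) ∘ eq := funext he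
  rw [this]
  exact htb'.comp_equiv eq

open TensorProduct in
/-- The derivations of a field of characteristic zero that are dual to an algebraically
independent family. -/
theorem exists_derivation_dual {k K ι : Type*} [Field k] [CharZero k] [Field K] [Algebra k K]
    [DecidableEq ι] (y : ι → K) (hy : AlgebraicIndependent k y) (i : ι) :
    ∃ δ : Derivation k K K, ∀ j, δ (y j) = if j = i then 1 else 0 := by
  classical
  have : CharZero K := charZero_of_injective_algebraMap (algebraMap k K).injective
  obtain ⟨T, hT, hTb⟩ := exists_isTranscendenceBasis_superset
    ((algebraicIndependent_subtype_range hy.injective).2 hy)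
  -- `K` is formally étale over the polynomial ring `P` on a transcendence basis containing `y`: a
  -- localization followed by a separable algebraic extension. Hence Kähler differentials base
  -- change from `P` to `K`, and a derivation prescribed on the variables extends to `K`.
  let P := MvPolynomial T k
  let : Algebra P K := (MvPolynomial.aeval (R := k) (Subtype.val : T → K)).toRingHom.toAlgebra
  have : IsScalarTower k P K := IsScalarTower.of_algebraMap_eq fun x => by
    simp [RingHom.algebraMap_toAlgebra, P]
  have hinj : Function.Injective (algebraMap P K) := hTb.1
  have : FaithfulSMul P K := (faithfulSMul_iff_algebraMap_injective _ _).2 hinj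
  let : Algebra (FractionRing P) K := FractionRing.liftAlgebra P K
  have : IsScalarTower P (FractionRing P) K := inferInstance
  have : Algebra.IsAlgebraic P K := by
    have := hTb.isAlgebraic
    refine ⟨fun x => ?_⟩
    obtain ⟨p, hp, hpx⟩ := this.1 x
    let f := hTb.1.aevalEquiv.symm
    have hf : (algebraMap P K).comp (f : _ →+* P) =
        algebraMap (Algebra.adjoin k (Set.range (Subtype.val : T → K))) K := by
      ext z
      have := hTb.1.algebraMap_aevalEquiv (f z)
      simpa [f, RingHom.algebraMap_toAlgebra, P] using this.symm
    refine ⟨p.map (f : _ →+* P), ?_, ?_⟩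
    · exact (Polynomial.map_ne_zero_iff f.injective).2 hp
    · rw [Polynomial.aeval_def, Polynomial.eval₂_map, hf]
      exact hpx
  have : Algebra.IsAlgebraic (FractionRing P) K :=
    Algebra.IsAlgebraic.extendScalars (R := P) (IsFractionRing.injective P (FractionRing P))
  have : Algebra.FormallyEtale P (FractionRing P) :=
    Algebra.FormallyEtale.of_isLocalization (nonZeroDivisors P)
  have : CharZero (FractionRing P) :=
    charZero_of_injective_algebraMap (algebraMap k (FractionRing P)).injective
  have : Algebra.FormallyEtale (FractionRing P) K := Algebra.FormallyEtale.of_isSeparable _ _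
  have : Algebra.FormallyEtale P K := Algebra.FormallyEtale.comp P (FractionRing P) K
  let i' : T := ⟨y i, hT ⟨i, rfl⟩⟩
  let D₀ : Derivation k P K := MvPolynomial.mkDerivation k (fun t => if t = i' then 1 else 0)
  let E := KaehlerDifferential.tensorKaehlerEquivOfFormallyEtale k P K
  let L : K ⊗[P] Ω[P⁄k] →ₗ[K] K := D₀.liftKaehlerDifferential.liftBaseChange K
  refine ⟨(L ∘ₗ E.symm.toLinearMap).compDer (KaehlerDifferential.D k K), fun j => ?_⟩
  let j' : T := ⟨y j, hT ⟨j, rfl⟩⟩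
  have h1 : y j = algebraMap P K (MvPolynomial.X j') := by
    simp [RingHom.algebraMap_toAlgebra, P, j']
  have h2 : E.symm (KaehlerDifferential.D k K (y j)) =
      1 ⊗ₜ KaehlerDifferential.D k P (MvPolynomial.X j') := by
    rw [h1]
    exact KaehlerDifferential.tensorKaehlerEquivOfFormallyEtale_symm_D_algebraMap k P K _
  have h3 : (j' = i') ↔ j = i := by
    simp [j', i', hy.injective.eq_iff]
  change L (E.symm (KaehlerDifferential.D k K (y j))) = _
  rw [h2, LinearMap.liftBaseChange_tmul, Derivation.liftKaehlerDifferential_comp_D, one_smul]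
  rw [MvPolynomial.mkDerivation_X]
  simp only [h3]

/-- A derivation of a domain of characteristic zero kills the elements that are algebraic over
a subalgebra on which it vanishes. -/
theorem derivation_eq_zero_of_isAlgebraic {k A : Type*} [Field k] [CharZero k] [CommRing A]
    [IsDomain A] [Algebra k A] (D : Derivation k A A) (C : Subalgebra k A)
    (hC : ∀ c ∈ C, D c = 0) {a : A} (ha : IsAlgebraic C a) : D a = 0 := by
  have : CharZero A := charZero_of_injective_algebraMap (algebraMap k A).injective
  have : CharZero C := charZero_of_injective_algebraMap (algebraMap k C).injective
  have hder : ∀ p : Polynomial C,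
      D (Polynomial.aeval a p) = Polynomial.aeval a (Polynomial.derivative p) * D a := by
    intro p
    induction p using Polynomial.induction_on' with
    | add p q hp hq => simp [hp, hq, add_mul]
    | monomial n c =>
      rw [Polynomial.aeval_monomial, Polynomial.derivative_monomial, Polynomial.aeval_monomial]
      have : D (algebraMap C A c) = 0 := hC _ c.2
      simp only [Derivation.leibniz, Derivation.leibniz_pow, this, smul_eq_mul, map_mul,
        map_natCast, mul_zero, add_zero, nsmul_eq_mul]
      ring
  -- Applying `D` to `p(a) = 0` gives `p'(a) * D a = 0`. Either `D a = 0`, or `p'` is a nonzero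
  -- polynomial of smaller degree vanishing at `a`.
  have key : ∀ n, ∀ p : Polynomial C, p.natDegree ≤ n → p ≠ 0 → Polynomial.aeval a p = 0 →
      D a = 0 := by
    intro n
    induction n with
    | zero =>
      intro p hn hp hpa
      exfalso
      rw [Polynomial.eq_C_of_natDegree_le_zero hn] at hpa hp
      simp only [Polynomial.aeval_C] at hpa
      have : p.coeff 0 = 0 := Subtype.ext hpa
      simp [this] at hp
    | succ n ih =>
      intro p hn hp hpa
      by_cases h0 : p.natDegree = 0
      · exact ih p (by omega) hp hpa
      have h := hder p
      rw [hpa, map_zero] at h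
      rcases mul_eq_zero.1 h.symm with h | h
      · refine ih (Polynomial.derivative p) ?_ ?_ h
        · exact (Polynomial.natDegree_derivative_le p).trans (by omega)
        · intro hd
          exact h0 (Polynomial.derivative_eq_zero.1 hd)
      · exact h
  obtain ⟨p, hp, hpa⟩ := ha
  exact key _ p le_rfl hp hpa

end CommutativeAlgebra

/-! ### Polynomial maps and directional derivatives. -/

section PolynomialMaps

variable {U V W : Type*} [AddCommGroup U] [Module ℂ U] [AddCommGroup V] [Module ℂ V]
  [AddCommGroup W] [Module ℂ W]

theorem dual_mem_polyFun (φ : Module.Dual ℂ V) : (φ : V → ℂ) ∈ polyFun V :=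
  Algebra.subset_adjoin ⟨φ, rfl⟩

/-- A map between complex vector spaces is polynomial if its composition with every linear form
is a polynomial function. -/
def IsPolyMap (F : V → W) : Prop :=
  ∀ φ : Module.Dual ℂ W, (fun x => φ (F x)) ∈ polyFun V

theorem IsPolyMap.comp_mem {F : V → W} (hF : IsPolyMap F) {f : W → ℂ} (hf : f ∈ polyFun W) :
    (fun x => f (F x)) ∈ polyFun V := by
  induction hf using Algebra.adjoin_induction with
  | mem f hf => obtain ⟨φ, rfl⟩ := hf; exact hF φ
  | algebraMap c => exact (polyFun V).algebraMap_mem c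
  | add f g _ _ hf hg => exact (polyFun V).add_mem hf hg
  | mul f g _ _ hf hg => exact (polyFun V).mul_mem hf hg

theorem IsPolyMap.comp {F : V → W} (hF : IsPolyMap F) {H : U → V} (hH : IsPolyMap H) :
    IsPolyMap fun x => F (H x) :=
  fun φ => hH.comp_mem (hF φ)

theorem isPolyMap_linear (g : V →ₗ[ℂ] W) : IsPolyMap g :=
  fun φ => dual_mem_polyFun (φ ∘ₗ g)

theorem isPolyMap_const (w : W) : IsPolyMap fun _ : V => w :=
  fun φ => (polyFun V).algebraMap_mem (φ w)

theorem IsPolyMap.add {F H : V → W} (hF : IsPolyMap F) (hH : IsPolyMap H) :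
    IsPolyMap fun x => F x + H x := fun φ => by
  simp only [map_add]
  exact (polyFun V).add_mem (hF φ) (hH φ)

theorem IsPolyMap.smul {f : V → ℂ} (hf : f ∈ polyFun V) {F : V → W} (hF : IsPolyMap F) :
    IsPolyMap fun x => f x • F x := fun φ => by
  simp only [map_smul, smul_eq_mul]
  exact (polyFun V).mul_mem hf (hF φ)

theorem IsPolyMap.sum {α : Type*} (s : Finset α) {F : α → V → W} (hF : ∀ a ∈ s, IsPolyMap (F a)) :
    IsPolyMap fun x => ∑ a ∈ s, F a x := fun φ => by
  have : (fun x => φ (∑ a ∈ s, F a x)) = ∑ a ∈ s, fun x => φ (F a x) := by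
    ext x; simp
  rw [this]
  exact (polyFun V).sum_mem fun a ha => hF a ha φ

theorem IsPolyMap.pi {ι : Type*} [Finite ι] {F : ι → V → W} (hF : ∀ i, IsPolyMap (F i)) :
    IsPolyMap fun x i => F i x := by
  classical
  have := Fintype.ofFinite ι
  have h : (fun x i => F i x) = fun x => ∑ i, LinearMap.single ℂ (fun _ => W) i (F i x) := by
    ext x j
    simp [Finset.sum_apply, Pi.single_apply]
  rw [h]
  exact IsPolyMap.sum _ fun i _ => (isPolyMap_linear _).comp (hF i)

theorem isPolyMap_update {ι : Type*} [DecidableEq ι] (a : ι → V) (i : ι) :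
    IsPolyMap fun x : V => Function.update a i x := by
  have h : (fun x : V => Function.update a i x) =
      fun x => LinearMap.single ℂ (fun _ => V) i x + Function.update a i 0 := by
    ext x j
    by_cases hj : j = i
    · subst hj; simp
    · simp [hj]
  rw [h]
  exact (isPolyMap_linear _).add (isPolyMap_const _)

/-- Induction on generators yields a differential that is linear in the direction at every point,
without a norm or coordinates on `V`. The second clause makes differentiation along a polynomial
vector field an operation on `ℂ[V]`. -/
theorem exists_gradient {f : V → ℂ} (hf : f ∈ polyFun V) :
    ∃ D : V → Module.Dual ℂ V, (∀ x v, HasDerivAt (fun t : ℂ => f (x + t • v)) (D x v) 0) ∧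
      ∀ F : V → V, IsPolyMap F → (fun x => D x (F x)) ∈ polyFun V := by
  induction hf using Algebra.adjoin_induction with
  | mem f hf =>
    obtain ⟨φ, rfl⟩ := hf
    refine ⟨fun _ => φ, fun x v => ?_, fun F hF => hF φ⟩
    have : (fun t : ℂ => φ (x + t • v)) = fun t => φ x + t * φ v := by ext t; simp
    rw [this]
    simpa using ((hasDerivAt_id (0 : ℂ)).mul_const (φ v)).const_add (φ x)
  | algebraMap c =>
    exact ⟨fun _ => 0, fun x v => hasDerivAt_const _ _, fun F _ => (polyFun V).zero_mem⟩
  | add f g hf' hg' hf hg =>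
    obtain ⟨D, hD, hDF⟩ := hf
    obtain ⟨E, hE, hEF⟩ := hg
    exact ⟨fun x => D x + E x, fun x v => (hD x v).add (hE x v),
      fun F hF => (polyFun V).add_mem (hDF F hF) (hEF F hF)⟩
  | mul f g hf' hg' hf hg =>
    obtain ⟨D, hD, hDF⟩ := hf
    obtain ⟨E, hE, hEF⟩ := hg
    refine ⟨fun x => g x • D x + f x • E x, fun x v => ?_, fun F hF => ?_⟩
    · refine ((hD x v).mul (hE x v)).congr_deriv ?_
      simp [mul_comm]
    · exact (polyFun V).add_mem ((polyFun V).mul_mem hg' (hDF F hF))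
        ((polyFun V).mul_mem hf' (hEF F hF))

theorem hasDerivAt_lineDeriv {f : V → ℂ} (hf : f ∈ polyFun V) (x v : V) :
    HasDerivAt (fun t : ℂ => f (x + t • v)) (lineDeriv ℂ f x v) 0 := by
  obtain ⟨D, hD, -⟩ := exists_gradient hf
  rw [lineDeriv, (hD x v).deriv]
  exact hD x v

theorem lineDeriv_mem_polyFun {f : V → ℂ} (hf : f ∈ polyFun V) {F : V → V} (hF : IsPolyMap F) :
    (fun x => lineDeriv ℂ f x (F x)) ∈ polyFun V := by
  obtain ⟨D, hD, hDF⟩ := exists_gradient hf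
  convert hDF F hF using 2 with x
  exact (hD x _).deriv

theorem lineDeriv_dir_add {f : V → ℂ} (hf : f ∈ polyFun V) (x v w : V) :
    lineDeriv ℂ f x (v + w) = lineDeriv ℂ f x v + lineDeriv ℂ f x w := by
  obtain ⟨D, hD, -⟩ := exists_gradient hf
  rw [lineDeriv, lineDeriv, lineDeriv, (hD x _).deriv, (hD x _).deriv, (hD x _).deriv, map_add]

theorem lineDeriv_dir_smul {f : V → ℂ} (hf : f ∈ polyFun V) (x v : V) (c : ℂ) :
    lineDeriv ℂ f x (c • v) = c * lineDeriv ℂ f x v := by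
  obtain ⟨D, hD, -⟩ := exists_gradient hf
  rw [lineDeriv, lineDeriv, (hD x _).deriv, (hD x _).deriv, map_smul, smul_eq_mul]

theorem lineDeriv_dual (φ : Module.Dual ℂ V) (x v : V) :
    lineDeriv ℂ (φ : V → ℂ) x v = φ v := by
  have : (fun t : ℂ => φ (x + t • v)) = fun t => φ x + t * φ v := by ext t; simp
  rw [lineDeriv, this]
  simp

theorem lineDeriv_comp_linear (f : W → ℂ) (g : V →ₗ[ℂ] W) (x v : V) :
    lineDeriv ℂ (fun y => f (g y)) x v = lineDeriv ℂ f (g x) (g v) := by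
  simp [lineDeriv]

/-- The derivation of `ℂ[V]` defined by a polynomial vector field. -/
noncomputable def vectorFieldDerivation (F : V → V) (hF : IsPolyMap F) :
    Derivation ℂ (polyFun V) (polyFun V) :=
  Derivation.mk'
    { toFun := fun f => ⟨fun x => lineDeriv ℂ (f : V → ℂ) x (F x), lineDeriv_mem_polyFun f.2 hF⟩
      map_add' := fun f g => Subtype.ext <| funext fun x =>
        ((hasDerivAt_lineDeriv f.2 x (F x)).add (hasDerivAt_lineDeriv g.2 x (F x))).deriv
      map_smul' := fun c f => Subtype.ext <| funext fun x =>
        ((hasDerivAt_lineDeriv f.2 x (F x)).const_mul c).deriv }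
    (fun f g => Subtype.ext <| funext fun x => by
      refine (((hasDerivAt_lineDeriv f.2 x (F x)).mul
        (hasDerivAt_lineDeriv g.2 x (F x))).deriv).trans ?_
      simp [mul_comm, add_comm])

theorem vectorFieldDerivation_apply (F : V → V) (hF : IsPolyMap F) (f : polyFun V) (x : V) :
    (vectorFieldDerivation F hF f : V → ℂ) x = lineDeriv ℂ (f : V → ℂ) x (F x) :=
  rfl

end PolynomialMaps

/-! ### Tangent vector fields and tangent spaces. -/

section Tangent

variable {V W : Type*} [AddCommGroup V] [Module ℂ V] [AddCommGroup W] [Module ℂ W]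

/-- A polynomial vector field is tangent to `Y` if it preserves the ideal of `Y`. -/
structure IsTangentField (Y : Set V) (F : V → V) : Prop where
  isPolyMap : IsPolyMap F
  lineDeriv_eq_zero : ∀ f ∈ vanishingIdeal Y, ∀ x ∈ Y, lineDeriv ℂ (f : V → ℂ) x (F x) = 0

theorem IsTangentField.add {Y : Set V} {F H : V → V} (hF : IsTangentField Y F)
    (hH : IsTangentField Y H) : IsTangentField Y fun x => F x + H x :=
  ⟨hF.1.add hH.1, fun f hf x hx => by
    rw [lineDeriv_dir_add f.2, hF.2 f hf x hx, hH.2 f hf x hx, add_zero]⟩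

theorem IsTangentField.smul {Y : Set V} {F : V → V} (hF : IsTangentField Y F) {h : V → ℂ}
    (hh : h ∈ polyFun V) : IsTangentField Y fun x => h x • F x :=
  ⟨hF.1.smul hh, fun f hf x hx => by
    rw [lineDeriv_dir_smul f.2, hF.2 f hf x hx, mul_zero]⟩

theorem isTangentField_zero (Y : Set V) : IsTangentField Y fun _ => 0 :=
  ⟨isPolyMap_const 0, fun f _ x _ => by
    simpa using lineDeriv_dir_smul f.2 x (0 : V) 0⟩

/-- The space of values at `y` of the polynomial vector fields tangent to `Y`. It is the tangent
space of `Y` at a general point. -/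
def tangent (Y : Set V) (y : V) : Submodule ℂ V where
  carrier := {v | ∃ F, IsTangentField Y F ∧ F y = v}
  zero_mem' := ⟨_, isTangentField_zero Y, rfl⟩
  add_mem' := by
    rintro _ _ ⟨F, hF, rfl⟩ ⟨H, hH, rfl⟩
    exact ⟨_, hF.add hH, rfl⟩
  smul_mem' := by
    rintro c _ ⟨F, hF, rfl⟩
    exact ⟨_, hF.smul ((polyFun V).algebraMap_mem c), rfl⟩

/-- Conjugating a tangent field by `g` gives a tangent field, because composition with `g` preserves
the ideal of `Y`. -/
theorem map_tangent_le {Y : Set V} (g : V ≃ₗ[ℂ] V) (hg : ∀ y, g y ∈ Y ↔ y ∈ Y) (y : V) :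
    (tangent Y y).map (g : V →ₗ[ℂ] V) ≤ tangent Y (g y) := by
  rintro _ ⟨_, ⟨F, hF, rfl⟩, rfl⟩
  refine ⟨fun x => g (F (g.symm x)), ⟨?_, fun f hf x hx => ?_⟩, by simp⟩
  · exact (isPolyMap_linear (g : V →ₗ[ℂ] V)).comp
      (hF.1.comp (isPolyMap_linear (g.symm : V →ₗ[ℂ] V)))
  · obtain ⟨x, rfl⟩ := g.surjective x
    have h := lineDeriv_comp_linear (f : V → ℂ) (g : V →ₗ[ℂ] V) x (F x)
    simp only [LinearEquiv.coe_coe] at h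
    rw [g.symm_apply_apply, ← h]
    exact hF.2 ⟨_, (isPolyMap_linear (g : V →ₗ[ℂ] V)).comp_mem f.2⟩
      (fun v hv => hf _ ((hg v).2 hv)) x ((hg x).1 hx)

theorem tangent_apply {Y : Set V} (g : V ≃ₗ[ℂ] V) (hg : ∀ y, g y ∈ Y ↔ y ∈ Y) (y : V) :
    tangent Y (g y) = (tangent Y y).map (g : V →ₗ[ℂ] V) := by
  refine le_antisymm ?_ (map_tangent_le g hg y)
  intro v hv
  have := map_tangent_le g.symm (fun z => by rw [← hg]; simp) (g y)
    (Submodule.mem_map_of_mem hv)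
  rw [g.symm_apply_apply] at this
  exact ⟨_, this, by simp⟩

/-- The tangent space of a product is the product of the tangent spaces. -/
theorem mem_tangent_pi {ι : Type*} [Finite ι] (Y : ι → Set V) {y : ι → V} (hy : ∀ i, y i ∈ Y i)
    {v : ι → V} : v ∈ tangent (Set.univ.pi Y) y ↔ ∀ i, v i ∈ tangent (Y i) (y i) := by
  classical
  constructor
  · rintro ⟨F, hF, rfl⟩ i
    -- Freeze all entries except the `i`-th at the point `y` and project the field to the `i`-th
    -- factor.
    refine ⟨fun x => F (Function.update y i x) i, ⟨?_, fun f hf x hx => ?_⟩, by simp⟩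
    · exact (isPolyMap_linear (LinearMap.proj (R := ℂ) (φ := fun _ : ι => V) i)).comp
        (hF.1.comp (isPolyMap_update y i))
    · have hp := isPolyMap_linear (LinearMap.proj (R := ℂ) (φ := fun _ : ι => V) i)
      have h := hF.2 ⟨_, hp.comp_mem f.2⟩ (fun z hz => hf _ (hz i trivial))
        (Function.update y i x) (fun j _ => by
          by_cases hj : j = i
          · subst hj; simpa using hx
          · simpa [hj] using hy j)
      have h' := lineDeriv_comp_linear (f : V → ℂ)
        (LinearMap.proj (R := ℂ) (φ := fun _ : ι => V) i) (Function.update y i x)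
        (F (Function.update y i x))
      rw [h] at h'
      simpa using h'.symm
  · intro h
    choose F hF hFv using h
    refine ⟨fun x i => F i (x i), ⟨?_, fun f hf x hx => ?_⟩, funext hFv⟩
    · exact IsPolyMap.pi fun i => (hF i).1.comp
        (isPolyMap_linear (LinearMap.proj (R := ℂ) (φ := fun _ : ι => V) i))
    · have := Fintype.ofFinite ι
      obtain ⟨D, hD, -⟩ := exists_gradient f.2
      rw [lineDeriv, (hD x _).deriv]
      -- The differential splits over the factors. Each summand differentiates a slice of `f`, which
      -- lies in the ideal of `Y i`, along the field `F i`.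
      rw [← Finset.univ_sum_single (fun i => F i (x i)), map_sum]
      refine Finset.sum_eq_zero fun i _ => ?_
      have h1 := (hF i).2 ⟨_, (isPolyMap_update x i).comp_mem f.2⟩ (fun z hz => hf _ (by
        intro j _
        by_cases hj : j = i
        · subst hj; simpa using hz
        · simpa [hj] using hx j trivial)) (x i) (hx i trivial)
      rw [← h1, lineDeriv, ← (hD x (Pi.single i (F i (x i)))).deriv]
      congr 1
      funext t
      refine congrArg (f : (ι → V) → ℂ) (funext fun j => ?_)
      by_cases hj : j = i
      · subst hj; simp
      · simp [hj]

end Tangent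

/-! ### Linear forms as generators and as tests of independence. -/

section LinearForms

variable {U V : Type*} [AddCommGroup U] [Module ℂ U] [AddCommGroup V] [Module ℂ V]

/-- The pull back of polynomial functions along a linear map. -/
def compLinear (π : U →ₗ[ℂ] V) : polyFun V →ₐ[ℂ] polyFun U where
  toFun f := ⟨fun x => (f : V → ℂ) (π x), (isPolyMap_linear π).comp_mem f.2⟩
  map_one' := rfl
  map_mul' _ _ := rfl
  map_zero' := rfl
  map_add' _ _ := rfl
  commutes' _ := rfl

theorem compLinear_mem_vanishingIdeal {W : Set U} {π : U →ₗ[ℂ] V} {f : polyFun V} :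
    compLinear π f ∈ vanishingIdeal W ↔ f ∈ vanishingIdeal (π '' W) := by
  constructor
  · rintro h _ ⟨w, hw, rfl⟩
    exact h w hw
  · exact fun h w hw => h _ ⟨w, hw, rfl⟩

/-- A linear form as an element of `ℂ[V]`. -/
def linForm (φ : Module.Dual ℂ V) : polyFun V := ⟨φ, dual_mem_polyFun φ⟩

theorem linForm_add (φ ψ : Module.Dual ℂ V) : linForm (φ + ψ) = linForm φ + linForm ψ := rfl

theorem linForm_smul (c : ℂ) (φ : Module.Dual ℂ V) : linForm (c • φ) = c • linForm φ := rfl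

theorem linForm_sum {α : Type*} (s : Finset α) (φ : α → Module.Dual ℂ V) :
    linForm (∑ a ∈ s, φ a) = ∑ a ∈ s, linForm (φ a) :=
  map_sum ({ toFun := linForm, map_add' := linForm_add, map_smul' := linForm_smul } :
    Module.Dual ℂ V →ₗ[ℂ] polyFun V) φ s

theorem polyFun_induction {p : polyFun V → Prop} (lin : ∀ φ, p (linForm φ))
    (const : ∀ c, p (algebraMap ℂ _ c)) (add : ∀ f g, p f → p g → p (f + g))
    (mul : ∀ f g, p f → p g → p (f * g)) (f : polyFun V) : p f := by
  obtain ⟨f, hf⟩ := f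
  induction hf using Algebra.adjoin_induction with
  | mem f hf => obtain ⟨φ, rfl⟩ := hf; exact lin φ
  | algebraMap c => exact const c
  | add f g hf' hg' hf hg => exact add _ _ hf hg
  | mul f g hf' hg' hf hg => exact mul _ _ hf hg

theorem adjoin_coord_eq_top {ι : Type*} [Fintype ι] (b : Module.Basis ι ℂ V) :
    Algebra.adjoin ℂ (Set.range fun i => linForm (b.coord i)) = ⊤ := by
  refine eq_top_iff.2 fun f _ => ?_
  induction f using polyFun_induction with
  | lin φ =>
    have h : φ = ∑ i, φ (b i) • b.coord i := by
      refine b.ext fun j => ?_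
      classical
      simp
    rw [h, linForm_sum]
    refine sum_mem fun i _ => ?_
    rw [linForm_smul]
    exact Subalgebra.smul_mem _ (Algebra.subset_adjoin (Set.mem_range_self i)) _
  | const c => exact Subalgebra.algebraMap_mem _ c
  | add f g hf hg => exact Subalgebra.add_mem _ (hf trivial) (hg trivial)
  | mul f g hf hg => exact Subalgebra.mul_mem _ (hf trivial) (hg trivial)

theorem exists_dual_family {n : ℕ} {v : Fin n → V} (hv : LinearIndependent ℂ v) :
    ∃ φ : Fin n → Module.Dual ℂ V, ∀ i j, φ i (v j) = if j = i then 1 else 0 := by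
  obtain ⟨g, hg⟩ := LinearMap.exists_leftInverse_of_injective
    (Fintype.linearCombination ℂ v) (by
      rw [LinearMap.ker_eq_bot]; exact hv.fintypeLinearCombination_injective)
  refine ⟨fun i => LinearMap.proj i ∘ₗ g, fun i j => ?_⟩
  have h := congrArg (fun f => f (Pi.single j 1) i) hg
  simp [Fintype.linearCombination_apply_single] at h
  rw [LinearMap.comp_apply, LinearMap.proj_apply, h, Pi.single_apply]
  simp [eq_comm]

theorem exists_linearIndependent_of_le_finrank [FiniteDimensional ℂ V] {n : ℕ} {S : Submodule ℂ V}
    (h : n ≤ Module.finrank ℂ S) : ∃ v : Fin n → V, LinearIndependent ℂ v ∧ ∀ i, v i ∈ S := by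
  let b := Module.finBasis ℂ S
  refine ⟨fun i => b (Fin.castLE h i), ?_, fun i => (b _).2⟩
  exact ((b.linearIndependent.comp _ (Fin.castLE_injective h)).map' S.subtype (by simp))

end LinearForms

/-! ### Dimension of a linear image as the generic rank on tangent spaces. -/

section ImageDimension

variable {U V A : Type*} [AddCommGroup U] [Module ℂ U] [AddCommGroup V] [Module ℂ V]
  [CommRing A] [Algebra ℂ A]

/-- The algebra `A` is, through `q`, the coordinate ring of `W`. -/
structure IsCoordRing (W : Set U) (q : polyFun U →ₐ[ℂ] A) : Prop where
  surjective : Function.Surjective q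
  eq_zero_iff : ∀ f, q f = 0 ↔ f ∈ vanishingIdeal W

/-- The projection of `ℂ[U]` onto the coordinate ring of `W`. -/
def coordProj (W : Set U) : polyFun U →ₐ[ℂ] polyFun U ⧸ vanishingIdeal W where
  toRingHom := Ideal.Quotient.mk (vanishingIdeal W)
  commutes' _ := rfl

theorem isCoordRing_coordProj (W : Set U) :
    IsCoordRing (A := polyFun U ⧸ vanishingIdeal W) W (coordProj W) :=
  ⟨Ideal.Quotient.mk_surjective, fun _ => Ideal.Quotient.eq_zero_iff_mem⟩

/-- Pull-back embeds the coordinate ring of the image into that of `W`. The image need not be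
closed, since `zdim` depends only on the vanishing ideal. -/
theorem IsCoordRing.zdim_image {W : Set U} {q : polyFun U →ₐ[ℂ] A} (hq : IsCoordRing W q)
    (π : U →ₗ[ℂ] V) : zdim (π '' W) = ringKrullDim (q.comp (compLinear π)).range := by
  have h : vanishingIdeal (π '' W) =
      RingHom.ker (q.comp (compLinear π)).rangeRestrict.toRingHom := by
    ext f
    rw [RingHom.mem_ker]
    change _ ↔ (q.comp (compLinear π)).rangeRestrict f = 0
    rw [← Subtype.coe_inj]
    change _ ↔ q (compLinear π f) = 0
    rw [hq.eq_zero_iff, compLinear_mem_vanishingIdeal]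
  rw [zdim, h]
  exact ringKrullDim_eq_of_ringEquiv
    (RingHom.quotientKerEquivOfSurjective (f := (q.comp (compLinear π)).rangeRestrict.toRingHom)
      (AlgHom.rangeRestrict_surjective _))

/-- The derivation of the coordinate ring of `W` defined by a tangent vector field. -/
theorem IsCoordRing.exists_derivation {W : Set U} {q : polyFun U →ₐ[ℂ] A} (hq : IsCoordRing W q)
    {F : U → U} (hF : IsTangentField W F) :
    ∃ D : Derivation ℂ A A, ∀ f, D (q f) = q (vectorFieldDerivation F hF.1 f) :=
  ⟨Derivation.liftOfSurjective hq.surjective (d := vectorFieldDerivation F hF.1) fun f hf => by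
      rw [hq.eq_zero_iff] at hf ⊢
      exact hF.2 f hf,
    fun f => Derivation.liftOfSurjective_apply hq.surjective _ f⟩

theorem IsCoordRing.exists_eval {W : Set U} {q : polyFun U →ₐ[ℂ] A} (hq : IsCoordRing W q)
    {w : U} (hw : w ∈ W) : ∃ ev : A →+* ℂ, ∀ f, ev (q f) = (f : U → ℂ) w := by
  let ev₀ : polyFun U →+* ℂ :=
    (Pi.evalRingHom (fun _ : U => ℂ) w).comp (polyFun U).val.toRingHom
  refine ⟨RingHom.liftOfSurjective (q : polyFun U →+* A) hq.surjective ⟨ev₀, fun f hf => ?_⟩,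
    fun f => RingHom.liftOfRightInverse_comp_apply _ _ _ ⟨ev₀, _⟩ f⟩
  rw [RingHom.mem_ker] at hf ⊢
  exact (hq.eq_zero_iff f).1 hf w hw

/-- If `d + 1` tangent fields had independent images at `w`, their derivations applied to dual
linear forms would have a matrix with determinant `1` at `w`. But some nontrivial `A`-combination
`E` of `d + 1` derivations kills the `d` elements of the transcendence basis, hence everything
algebraic over them, including these linear forms. So the determinant is zero. The bound holds at
every point of `W`. -/
theorem IsCoordRing.finrank_map_tangent_le [FiniteDimensional ℂ V] [IsDomain A] {W : Set U}
    {q : polyFun U →ₐ[ℂ] A} (hq : IsCoordRing W q) (π : U →ₗ[ℂ] V) {d : ℕ}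
    (b : Fin d → (q.comp (compLinear π)).range) (hb : IsTranscendenceBasis ℂ b)
    {w : U} (hw : w ∈ W) :
    Module.finrank ℂ ((tangent W w).map π) ≤ d := by
  classical
  by_contra! hlt
  obtain ⟨v, hv, hvS⟩ := exists_linearIndependent_of_le_finrank (Nat.succ_le_of_lt hlt)
  obtain ⟨φ, hφ⟩ := exists_dual_family hv
  have hF : ∀ j, ∃ F, IsTangentField W F ∧ π (F w) = v j := by
    intro j
    obtain ⟨_, ⟨F, hF, rfl⟩, h⟩ := hvS j
    exact ⟨F, hF, h⟩
  choose F hF hFv using hF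
  choose D hD using fun j => hq.exists_derivation (hF j)
  obtain ⟨ev, hev⟩ := hq.exists_eval hw
  let M : Matrix (Fin (d + 1)) (Fin (d + 1)) (A) :=
    Matrix.of fun j i => D j (q (compLinear π (linForm (φ i))))
  have hM : M.det ≠ 0 := by
    intro h
    have h1 : ev.mapMatrix M = 1 := by
      ext j i
      have : ev (M j i) = φ i (π (F j w)) := by
        simp only [M, Matrix.of_apply, hD, hev]
        change lineDeriv ℂ (fun x => φ i (π x)) w (F j w) = _
        exact lineDeriv_dual (φ i ∘ₗ π) w _
      rw [RingHom.mapMatrix_apply, Matrix.map_apply, this, hFv, hφ, Matrix.one_apply]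
    have h2 := congrArg ev h
    rw [RingHom.map_det, h1, Matrix.det_one, map_zero] at h2
    exact one_ne_zero h2
  have hex : ∃ a : Fin (d + 1) → A, a ≠ 0 ∧
      ∀ i, ∑ j, a j * D j (b i : A) = 0 := by
    have hnot : ¬ LinearIndependent (A)
        (fun j i => D j (b i : A)) := by
      intro hli
      have := hli.fintype_card_le_finrank
      simp at this
    rw [Fintype.not_linearIndependent_iff] at hnot
    obtain ⟨a, ha, j, hj⟩ := hnot
    refine ⟨a, fun h => hj (congrFun h j), fun i => ?_⟩
    simpa using congrFun ha i
  obtain ⟨a, ha, hab⟩ := hex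
  let E : Derivation ℂ A (A) :=
    ∑ j, a j • D j
  have hE : ∀ x, E x = ∑ j, a j * D j x := by
    intro x
    change (∑ j, a j • D j) x = _
    rw [← Derivation.coeFnAddMonoidHom_apply, map_sum, Finset.sum_apply]
    rfl
  let C : Subalgebra ℂ A :=
    Algebra.adjoin ℂ (Set.range fun i => (b i : A))
  have hC : ∀ c ∈ C, E c = 0 := by
    have h : Set.EqOn E (0 : Derivation ℂ A _)
        (Set.range fun i => (b i : A)) := by
      rintro _ ⟨i, rfl⟩
      simpa [hE] using hab i
    exact fun c hc => Derivation.eqOn_adjoin h hc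
  have hrange : ∀ x : (q.comp (compLinear π)).range, E x = 0 := by
    intro x
    refine derivation_eq_zero_of_isAlgebraic E C hC ?_
    have hmem : ∀ c : Algebra.adjoin ℂ (Set.range b),
        ((c : (q.comp (compLinear π)).range) : A) ∈ C := by
      rintro ⟨c, hc⟩
      have h : (c : A) ∈ (Algebra.adjoin ℂ (Set.range b)).map
          (q.comp (compLinear π)).range.val := ⟨c, hc, rfl⟩
      rw [AlgHom.map_adjoin, ← Set.range_comp] at h
      exact h
    let g : Algebra.adjoin ℂ (Set.range b) →ₐ[ℂ] C :=
      ((q.comp (compLinear π)).range.val.comp (Algebra.adjoin ℂ (Set.range b)).val).codRestrict C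
        hmem
    have hg : Function.Injective g := fun c c' h =>
      Subtype.ext (Subtype.ext (congrArg (Subtype.val : C → A) h))
    exact (hb.isAlgebraic.1 x).ringHom_of_comp_eq g (q.comp (compLinear π)).range.val hg rfl
  refine hM (Matrix.exists_vecMul_eq_zero_iff.1 ⟨a, ha, funext fun i => ?_⟩)
  have := hrange ⟨_, ⟨linForm (φ i), rfl⟩⟩
  rw [hE] at this
  simpa [Matrix.vecMul, dotProduct, M] using this

/-- The derivations of the fraction field dual to the given forms become polynomial tangent fields
after clearing denominators by some `σ`. At a point of `W` with `σ ≠ 0` their images are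
independent. -/
theorem IsCoordRing.le_finrank_map_tangent [FiniteDimensional ℂ U] [FiniteDimensional ℂ V]
    [IsDomain A] {W : Set U} {q : polyFun U →ₐ[ℂ] A} (hq : IsCoordRing W q) (π : U →ₗ[ℂ] V)
    {d : ℕ} (φ : Fin d → Module.Dual ℂ V)
    (hφ : AlgebraicIndependent ℂ fun i => q (compLinear π (linForm (φ i)))) :
    ∃ w ∈ W, d ≤ Module.finrank ℂ ((tangent W w).map π) := by
  classical
  let K := FractionRing A
  have hinj : Function.Injective (algebraMap A K) := IsFractionRing.injective A K
  have hy : AlgebraicIndependent ℂ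
      fun i => algebraMap A K (q (compLinear π (linForm (φ i)))) :=
    hφ.map' (f := IsScalarTower.toAlgHom ℂ A K) hinj
  choose δ hδ using fun i => exists_derivation_dual _ hy i
  let x := Module.finBasis ℂ U
  let Q : polyFun U →ₐ[ℂ] K := (IsScalarTower.toAlgHom ℂ A K).comp q
  obtain ⟨s, hs⟩ := IsLocalization.exist_integer_multiples_of_finite (nonZeroDivisors A)
    (fun p : Fin d × Fin (Module.finrank ℂ U) => δ p.1 (Q (linForm (x.coord p.2))))
  choose a ha using hs
  choose p hp using fun ij => hq.surjective (a ij)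
  obtain ⟨σ, hσ⟩ := hq.surjective (s : A)
  have hQ : ∀ f, Q f = algebraMap A K (q f) := fun _ => rfl
  have hqp : ∀ i j, Q (p (i, j)) = Q σ * δ i (Q (linForm (x.coord j))) := by
    intro i j
    rw [hQ, hp, ha, hQ σ, hσ, Algebra.smul_def]
  let F : Fin d → U → U := fun i u => ∑ j, (p (i, j) : U → ℂ) u • x j
  have hF : ∀ i, IsPolyMap (F i) := fun i =>
    IsPolyMap.sum _ fun j _ => (isPolyMap_const (x j)).smul (p (i, j)).2
  -- Both sides satisfy the Leibniz rule along `Q`, so it is enough to compare them on linear forms,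
  -- where the choice of the `p (i, j)` applies.
  have key : ∀ i f, Q (vectorFieldDerivation (F i) (hF i) f) = Q σ * δ i (Q f) := by
    intro i f
    induction f using polyFun_induction with
    | lin ψ =>
      have h1 : vectorFieldDerivation (F i) (hF i) (linForm ψ) = ∑ j, ψ (x j) • p (i, j) := by
        refine Subtype.ext (funext fun u => ?_)
        rw [vectorFieldDerivation_apply]
        refine (lineDeriv_dual ψ u _).trans ?_
        simp [F, mul_comm]
      have h2 : ψ = ∑ j, ψ (x j) • x.coord j := by
        refine x.ext fun j => ?_
        simp
      rw [h1]
      nth_rw 2 [h2]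
      rw [linForm_sum]
      simp only [linForm_smul, map_sum, map_smul, hqp, Finset.mul_sum]
      refine Finset.sum_congr rfl fun j _ => ?_
      rw [Derivation.map_smul, mul_smul_comm]
    | const c => simp
    | add f g hf hg => rw [map_add, map_add, map_add, map_add, hf, hg, mul_add]
    | mul f g hf hg =>
      rw [Derivation.leibniz, map_mul, Derivation.leibniz, map_add, smul_eq_mul, smul_eq_mul,
        map_mul, map_mul, hf, hg, smul_eq_mul, smul_eq_mul]
      ring
  have hmem : ∀ f, Q f = 0 ↔ f ∈ vanishingIdeal W := by
    intro f
    rw [hQ, map_eq_zero_iff _ hinj, hq.eq_zero_iff]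
  have htan : ∀ i, IsTangentField W (F i) := fun i => ⟨hF i, fun f hf w hw => by
    have h := key i f
    rw [(hmem f).2 hf, map_zero, mul_zero, hmem] at h
    exact h w hw⟩
  have hσW : σ ∉ vanishingIdeal W := by
    rw [← hmem, hQ, hσ, map_eq_zero_iff _ hinj]
    exact nonZeroDivisors.ne_zero s.2
  obtain ⟨w, hw, hσw⟩ : ∃ w ∈ W, (σ : U → ℂ) w ≠ 0 := by
    by_contra! h
    exact hσW h
  refine ⟨w, hw, ?_⟩
  have hval : ∀ i k, φ k (π (F i w)) = if k = i then (σ : U → ℂ) w else 0 := by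
    intro i k
    have h := key i ⟨fun u => φ k (π u), (isPolyMap_linear π).comp_mem (linForm (φ k)).2⟩
    have h' : Q ⟨fun u => φ k (π u), (isPolyMap_linear π).comp_mem (linForm (φ k)).2⟩ =
      algebraMap A K (q (compLinear π (linForm (φ k)))) := rfl
    rw [h', hδ] at h
    have h2 : vectorFieldDerivation (F i) (hF i)
        ⟨fun u => φ k (π u), (isPolyMap_linear π).comp_mem (linForm (φ k)).2⟩ -
        (if k = i then σ else 0) ∈ vanishingIdeal W := by
      rw [← hmem, map_sub, h]
      split_ifs <;> simp
    have h3 := h2 w hw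
    have h4 := vectorFieldDerivation_apply (F i) (hF i)
        ⟨fun u => φ k (π u), (isPolyMap_linear π).comp_mem (linForm (φ k)).2⟩ w
    have h5 : lineDeriv ℂ (fun u => φ k (π u)) w (F i w) = φ k (π (F i w)) :=
      lineDeriv_dual (φ k ∘ₗ π) w (F i w)
    simp only [] at h4
    rw [h5] at h4
    have h6 : (vectorFieldDerivation (F i) (hF i)
        ⟨fun u => φ k (π u), (isPolyMap_linear π).comp_mem (linForm (φ k)).2⟩ : U → ℂ) w -
        ((if k = i then σ else 0 : polyFun U) : U → ℂ) w = 0 := h3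
    rw [h4, sub_eq_zero] at h6
    rw [h6]
    split_ifs <;> rfl
  have hli : LinearIndependent ℂ fun i => (⟨π (F i w), Submodule.mem_map_of_mem
      ⟨F i, htan i, rfl⟩⟩ : (tangent W w).map π) := by
    rw [Fintype.linearIndependent_iff]
    intro c hc k
    have h := congrArg (fun z : (tangent W w).map π => φ k z) hc
    simp only [Submodule.coe_sum, Submodule.coe_smul, map_sum, map_smul, hval, smul_eq_mul] at h
    simpa [hσw] using h
  simpa using hli.fintype_card_le_finrank

/-- The coordinate functions of `V` generate the coordinate ring of the image, so the transcendence
basis can be taken among them. This makes the upper and the lower bound meet. -/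
theorem IsCoordRing.exists_dim [FiniteDimensional ℂ U] [FiniteDimensional ℂ V]
    [IsDomain A] {W : Set U} {q : polyFun U →ₐ[ℂ] A} (hq : IsCoordRing W q) (π : U →ₗ[ℂ] V) :
    ∃ d : ℕ, zdim (π '' W) = d ∧ (∀ w ∈ W, Module.finrank ℂ ((tangent W w).map π) ≤ d) ∧
      ∃ w ∈ W, Module.finrank ℂ ((tangent W w).map π) = d := by
  let b := Module.finBasis ℂ V
  let ψ := q.comp (compLinear π)
  have hgen : Algebra.adjoin ℂ (Set.range fun i => ψ.rangeRestrict (linForm (b.coord i))) = ⊤ := by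
    have h := congrArg (Subalgebra.map ψ.rangeRestrict) (adjoin_coord_eq_top b)
    rw [AlgHom.map_adjoin, ← Set.range_comp, Algebra.map_top,
      (AlgHom.range_eq_top _).2 (AlgHom.rangeRestrict_surjective _)] at h
    exact h
  obtain ⟨d, e, htb, hdim⟩ := exists_transcendenceBasis_ringKrullDim _ hgen
  have hle : ∀ w ∈ W, Module.finrank ℂ ((tangent W w).map π) ≤ d := fun w hw =>
    hq.finrank_map_tangent_le π _ htb hw
  refine ⟨d, by rw [hq.zdim_image, hdim], hle, ?_⟩
  obtain ⟨w, hw, hdw⟩ := hq.le_finrank_map_tangent π (fun i => b.coord (e i))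
    (htb.1.map' (f := ψ.range.val) Subtype.val_injective)
  exact ⟨w, hw, le_antisymm (hle w hw) hdw⟩

/-- The dimension of a linear image of an irreducible set is the generic rank of the linear map
on the tangent spaces. -/
theorem zdim_image [FiniteDimensional ℂ U] [FiniteDimensional ℂ V] {W : Set U}
    (hW : (vanishingIdeal W).IsPrime) (π : U →ₗ[ℂ] V) :
    ∃ d : ℕ, zdim (π '' W) = d ∧ (∀ w ∈ W, Module.finrank ℂ ((tangent W w).map π) ≤ d) ∧
      ∃ w ∈ W, Module.finrank ℂ ((tangent W w).map π) = d := by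
  have : IsDomain (polyFun U ⧸ vanishingIdeal W) := Ideal.Quotient.isDomain _
  exact (isCoordRing_coordProj W).exists_dim π

end ImageDimension

open Filter

/-! ### Generic points of irreducible sets and of their products. -/

section Generic

variable {U V : Type*} [AddCommGroup U] [Module ℂ U] [AddCommGroup V] [Module ℂ V]

theorem nonempty_of_isPrime {Y : Set V} (hY : (vanishingIdeal Y).IsPrime) : Y.Nonempty := by
  by_contra h
  rw [Set.not_nonempty_iff_eq_empty] at h
  refine hY.ne_top ((Ideal.eq_top_iff_one _).2 ?_)
  subst h
  exact fun v hv => hv.elim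

theorem exists_common_ne_zero {Y : Set V} (hY : (vanishingIdeal Y).IsPrime) {f g : V → ℂ}
    (hf : f ∈ polyFun V) (hg : g ∈ polyFun V) (hfY : ∃ y ∈ Y, f y ≠ 0) (hgY : ∃ y ∈ Y, g y ≠ 0) :
    ∃ y ∈ Y, f y ≠ 0 ∧ g y ≠ 0 := by
  obtain ⟨y, hy, hfy⟩ := hfY
  obtain ⟨z, hz, hgz⟩ := hgY
  by_contra! h
  have hmem : (⟨f, hf⟩ : polyFun V) * ⟨g, hg⟩ ∈ vanishingIdeal Y := by
    intro v hv
    change f v * g v = 0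
    by_cases hfv : f v = 0
    · rw [hfv, zero_mul]
    · rw [h v hv hfv, mul_zero]
  rcases hY.mem_or_mem hmem with h' | h'
  · exact hfy (h' y hy)
  · exact hgz (h' z hz)

theorem isPrime_vanishingIdeal_of_common {Y : Set V} (hY : Y.Nonempty)
    (h : ∀ f g : V → ℂ, f ∈ polyFun V → g ∈ polyFun V → (∃ y ∈ Y, f y ≠ 0) → (∃ y ∈ Y, g y ≠ 0) →
      ∃ y ∈ Y, f y ≠ 0 ∧ g y ≠ 0) : (vanishingIdeal Y).IsPrime := by
  refine ⟨fun htop => ?_, fun {f g} hfg => ?_⟩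
  · obtain ⟨y, hy⟩ := hY
    have h1 : (1 : polyFun V) ∈ vanishingIdeal Y := htop ▸ Submodule.mem_top
    exact one_ne_zero (α := ℂ) (h1 y hy)
  · by_contra! hcon
    obtain ⟨hf, hg⟩ := hcon
    have hf' : ∃ y ∈ Y, (f : V → ℂ) y ≠ 0 := by
      by_contra! h'; exact hf h'
    have hg' : ∃ y ∈ Y, (g : V → ℂ) y ≠ 0 := by
      by_contra! h'; exact hg h'
    obtain ⟨y, hy, hfy, hgy⟩ := h _ _ f.2 g.2 hf' hg'
    exact mul_ne_zero hfy hgy (hfg y hy)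

/-- Points `a`, `b` with `f a ≠ 0` and `g b ≠ 0` are merged one coordinate at a time: on each slice,
irreducibility of a single factor provides a common entry. -/
theorem isPrime_vanishingIdeal_pi {ι : Type*} [Finite ι] {Y : ι → Set V}
    (hY : ∀ i, (vanishingIdeal (Y i)).IsPrime) : (vanishingIdeal (Set.univ.pi Y)).IsPrime := by
  classical
  have := Fintype.ofFinite ι
  refine isPrime_vanishingIdeal_of_common
    (Set.univ_pi_nonempty_iff.2 fun i => nonempty_of_isPrime (hY i)) ?_
  rintro f g hf hg ⟨a, ha, hfa⟩ ⟨b, hb, hgb⟩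
  have key : ∀ s : Finset ι, ∃ a ∈ Set.univ.pi Y, ∃ b ∈ Set.univ.pi Y, f a ≠ 0 ∧ g b ≠ 0 ∧
      ∀ i ∈ s, a i = b i := by
    intro s
    induction s using Finset.induction_on with
    | empty => exact ⟨a, ha, b, hb, hfa, hgb, by simp⟩
    | insert i s hi ih =>
      obtain ⟨a, ha, b, hb, hfa, hgb, hab⟩ := ih
      obtain ⟨x, hx, hfx, hgx⟩ := exists_common_ne_zero (hY i)
        ((isPolyMap_update a i).comp_mem hf) ((isPolyMap_update b i).comp_mem hg)
        ⟨a i, ha i trivial, by simpa using hfa⟩ ⟨b i, hb i trivial, by simpa using hgb⟩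
      refine ⟨_, (Set.update_mem_pi_iff_of_mem ha).2 fun _ => hx, _,
        (Set.update_mem_pi_iff_of_mem hb).2 fun _ => hx, hfx, hgx, fun j hj => ?_⟩
      by_cases hji : j = i
      · subst hji; simp
      · simpa [hji] using hab j (Finset.mem_of_mem_insert_of_ne hj hji)
  obtain ⟨a, ha, b, hb, hfa, hgb, hab⟩ := key Finset.univ
  obtain rfl : a = b := funext fun i => hab i (Finset.mem_univ i)
  exact ⟨a, ha, hfa, hgb⟩

/-- The filter of the subsets of `V` that contain a nonempty principal open subset of `Y`. -/
def generic (Y : Set V) : Filter V :=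
  ⨅ f ∈ {f : V → ℂ | f ∈ polyFun V ∧ ∃ y ∈ Y, f y ≠ 0}, 𝓟 {y | y ∈ Y ∧ f y ≠ 0}

/-- Irreducibility makes the nonempty principal open subsets a directed family, so one of them
witnesses each generic property. -/
theorem eventually_generic_iff {Y : Set V} (hY : (vanishingIdeal Y).IsPrime) {p : V → Prop} :
    (∀ᶠ y in generic Y, p y) ↔
      ∃ f ∈ polyFun V, (∃ y ∈ Y, f y ≠ 0) ∧ ∀ y ∈ Y, f y ≠ 0 → p y := by
  have h : {y | p y} ∈ generic Y ↔ ∃ f ∈ {f : V → ℂ | f ∈ polyFun V ∧ ∃ y ∈ Y, f y ≠ 0},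
      {y | p y} ∈ 𝓟 {y | y ∈ Y ∧ f y ≠ 0} := by
    refine mem_biInf_of_directed ?_ ?_
    · rintro f ⟨hf, hfY⟩ g ⟨hg, hgY⟩
      refine ⟨f * g, ⟨(polyFun V).mul_mem hf hg, ?_⟩, ?_, ?_⟩
      · obtain ⟨y, hy, hfy, hgy⟩ := exists_common_ne_zero hY hf hg hfY hgY
        exact ⟨y, hy, mul_ne_zero hfy hgy⟩
      · exact principal_mono.2 fun y hy => ⟨hy.1, left_ne_zero_of_mul hy.2⟩
      · exact principal_mono.2 fun y hy => ⟨hy.1, right_ne_zero_of_mul hy.2⟩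
    · obtain ⟨y, hy⟩ := nonempty_of_isPrime hY
      exact ⟨1, (polyFun V).one_mem, y, hy, one_ne_zero⟩
  refine h.trans ⟨?_, ?_⟩
  · rintro ⟨f, ⟨hf, hfY⟩, h⟩
    exact ⟨f, hf, hfY, fun y hy hfy => mem_principal.1 h ⟨hy, hfy⟩⟩
  · rintro ⟨f, hf, hfY, h⟩
    exact ⟨f, ⟨hf, hfY⟩, mem_principal.2 fun y hy => h y hy.1 hy.2⟩

theorem generic_neBot {Y : Set V} (hY : (vanishingIdeal Y).IsPrime) : (generic Y).NeBot := by
  rw [neBot_iff]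
  intro h
  have : ∀ᶠ y in generic Y, False := by rw [h]; exact eventually_bot
  obtain ⟨f, -, ⟨y, hy, hfy⟩, h⟩ := (eventually_generic_iff hY).1 this
  exact h y hy hfy

theorem eventually_mem_generic {Y : Set V} (hY : (vanishingIdeal Y).IsPrime) :
    ∀ᶠ y in generic Y, y ∈ Y :=
  (eventually_generic_iff hY).2
    ⟨1, (polyFun V).one_mem, (nonempty_of_isPrime hY).imp fun _ hy => ⟨hy, one_ne_zero⟩,
      fun _ hy _ => hy⟩

theorem tendsto_generic {X : Set U} {Y : Set V} (hX : (vanishingIdeal X).IsPrime)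
    (hY : (vanishingIdeal Y).IsPrime) {F : U → V} (hF : IsPolyMap F) (hFXY : F '' X = Y) :
    Tendsto F (generic X) (generic Y) := by
  intro S hS
  obtain ⟨f, hf, ⟨y, hy, hfy⟩, h⟩ := (eventually_generic_iff hY).1 hS
  obtain ⟨x, hx, rfl⟩ := hFXY.symm ▸ hy
  exact (eventually_generic_iff hX).2 ⟨_, hF.comp_mem hf, ⟨x, hx, hfy⟩,
    fun x hx hfx => h _ (hFXY ▸ ⟨x, hx, rfl⟩) hfx⟩

theorem tendsto_generic_pi_comp {ι κ : Type*} [Finite ι] [Finite κ] {Y : κ → Set V}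
    (hY : ∀ k, (vanishingIdeal (Y k)).IsPrime) {e : ι → κ} (he : Function.Injective e) :
    Tendsto (fun w : κ → V => fun i => w (e i)) (generic (Set.univ.pi Y))
      (generic (Set.univ.pi fun i => Y (e i))) := by
  classical
  refine tendsto_generic (isPrime_vanishingIdeal_pi hY)
    (isPrime_vanishingIdeal_pi fun i => hY (e i)) (isPolyMap_linear (LinearMap.funLeft ℂ V e)) ?_
  ext y
  constructor
  · rintro ⟨w, hw, rfl⟩ i _
    exact hw (e i) trivial
  · intro hy
    choose z hz using fun k => nonempty_of_isPrime (hY k)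
    refine ⟨Function.extend e y z, fun k _ => ?_, funext fun i => he.extend_apply _ _ _⟩
    by_cases hk : ∃ i, e i = k
    · obtain ⟨i, rfl⟩ := hk
      rw [he.extend_apply]
      exact hy i trivial
    · rw [Function.extend_apply' _ _ _ hk]
      exact hz k

/-- A generic property of pairs holds generically for the first and then for the second entry. -/
theorem eventually_generic_sum {α β : Type*} [Finite α] [Finite β] {Y : α → Set V}
    {Z : β → Set V} (hY : ∀ a, (vanishingIdeal (Y a)).IsPrime)
    (hZ : ∀ b, (vanishingIdeal (Z b)).IsPrime) {p : (α ⊕ β → V) → Prop}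
    (h : ∀ᶠ w in generic (Set.univ.pi (Sum.elim Y Z)), p w) :
    ∀ᶠ y in generic (Set.univ.pi Y), ∀ᶠ z in generic (Set.univ.pi Z), p (Sum.elim y z) := by
  have hYZ : ∀ c, (vanishingIdeal (Sum.elim Y Z c)).IsPrime := by
    rintro (a | b)
    · exact hY a
    · exact hZ b
  obtain ⟨f, hf, ⟨w, hw, hfw⟩, hp⟩ :=
    (eventually_generic_iff (isPrime_vanishingIdeal_pi hYZ)).1 h
  have h1 : ∀ z : β → V, IsPolyMap fun y : α → V => (Sum.elim y z : α ⊕ β → V) := fun z =>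
    IsPolyMap.pi (F := fun c (y : α → V) => Sum.elim y z c) (by
      rintro (a | b)
      · exact isPolyMap_linear (LinearMap.proj (R := ℂ) (φ := fun _ => V) a)
      · exact isPolyMap_const (z b))
  have h2 : ∀ y : α → V, IsPolyMap fun z : β → V => (Sum.elim y z : α ⊕ β → V) := fun y =>
    IsPolyMap.pi (F := fun c (z : β → V) => Sum.elim y z c) (by
      rintro (a | b)
      · exact isPolyMap_const (y a)
      · exact isPolyMap_linear (LinearMap.proj (R := ℂ) (φ := fun _ => V) b))
  rw [eventually_generic_iff (isPrime_vanishingIdeal_pi hY)]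
  have hwe : (Sum.elim (fun a => w (Sum.inl a)) (fun b => w (Sum.inr b)) : α ⊕ β → V) = w := by
    ext (a | b) <;> rfl
  refine ⟨_, (h1 fun b => w (Sum.inr b)).comp_mem hf,
    ⟨fun a => w (Sum.inl a), fun a _ => hw (Sum.inl a) trivial, by rwa [hwe]⟩, fun y hy hfy => ?_⟩
  rw [eventually_generic_iff (isPrime_vanishingIdeal_pi hZ)]
  refine ⟨_, (h2 y).comp_mem hf, ⟨_, fun b _ => hw (Sum.inr b) trivial, hfy⟩, fun z hz hfz => ?_⟩
  refine hp _ ?_ hfz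
  rintro (a | b) _
  · exact hy a trivial
  · exact hz b trivial

/-- Rank is lower semicontinuous: pairing fields that are independent at `w` with dual forms gives a
polynomial determinant, equal to `1` at `w`. -/
theorem eventually_le_finrank_map_tangent [FiniteDimensional ℂ V] {W : Set U}
    (hW : (vanishingIdeal W).IsPrime) (π : U →ₗ[ℂ] V) {d : ℕ} {w : U} (hw : w ∈ W)
    (hd : d ≤ Module.finrank ℂ ((tangent W w).map π)) :
    ∀ᶠ z in generic W, d ≤ Module.finrank ℂ ((tangent W z).map π) := by
  classical
  obtain ⟨v, hv, hvS⟩ := exists_linearIndependent_of_le_finrank hd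
  obtain ⟨φ, hφ⟩ := exists_dual_family hv
  have hF : ∀ j, ∃ F, IsTangentField W F ∧ π (F w) = v j := by
    intro j
    obtain ⟨_, ⟨F, hF, rfl⟩, h⟩ := hvS j
    exact ⟨F, hF, h⟩
  choose F hF hFv using hF
  let M : Matrix (Fin d) (Fin d) (polyFun U) := Matrix.of fun j i =>
    ⟨fun z => φ i (π (F j z)), (hF j).1.comp_mem (dual_mem_polyFun (φ i ∘ₗ π))⟩
  let ev : U → polyFun U →+* ℂ := fun z =>
    (Pi.evalRingHom (fun _ : U => ℂ) z).comp (polyFun U).val.toRingHom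
  have hdet : ∀ z, (M.det : U → ℂ) z = (Matrix.of fun j i => φ i (π (F j z))).det := by
    intro z
    exact RingHom.map_det (ev z) M
  rw [eventually_generic_iff hW]
  refine ⟨M.det, M.det.2, ⟨w, hw, ?_⟩, fun z hz hMz => ?_⟩
  · have h1 : (Matrix.of fun j i => φ i (π (F j w))) = (1 : Matrix (Fin d) (Fin d) ℂ) := by
      ext j i
      rw [Matrix.of_apply, hFv, hφ, Matrix.one_apply]
    rw [hdet, h1, Matrix.det_one]
    exact one_ne_zero
  · rw [hdet] at hMz
    have hli : LinearIndependent ℂ fun j => (⟨π (F j z), Submodule.mem_map_of_mem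
        ⟨F j, hF j, rfl⟩⟩ : (tangent W z).map π) := by
      rw [Fintype.linearIndependent_iff]
      intro c hc
      have hc' : Matrix.vecMul c (Matrix.of fun j i => φ i (π (F j z))) = 0 := by
        ext i
        have h := congrArg (fun u : (tangent W z).map π => φ i u) hc
        simp only [Submodule.coe_sum, Submodule.coe_smul, map_sum, map_smul, smul_eq_mul] at h
        simpa [Matrix.vecMul, dotProduct] using h
      exact congrFun (Matrix.eq_zero_of_vecMul_eq_zero hMz hc')
    simpa using hli.fintype_card_le_finrank

end Generic

/-! ### Terracini's lemma and the generic rank. -/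

section Rank

variable {V ι : Type*} [AddCommGroup V] [Module ℂ V]

/-- The sum of the tangent spaces of the `M i` at the points `y i`. -/
def tangentSum (M : ι → Set V) (y : ι → V) : Submodule ℂ V := ⨆ i, tangent (M i) (y i)

/-- The set of sums of a tuple of points. -/
def sumset [Fintype ι] (M : ι → Set V) : Set V := (fun y : ι → V => ∑ i, y i) '' Set.univ.pi M

theorem map_tangent_pi [Fintype ι] (M : ι → Set V) {y : ι → V} (hy : y ∈ Set.univ.pi M) :
    (tangent (Set.univ.pi M) y).map (∑ i, LinearMap.proj (R := ℂ) (φ := fun _ : ι => V) i) =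
      tangentSum M y := by
  classical
  have hy' : ∀ i, y i ∈ M i := fun i => hy i trivial
  apply le_antisymm
  · rintro _ ⟨v, hv, rfl⟩
    have hv' := (mem_tangent_pi M hy').1 hv
    simp only [LinearMap.sum_apply, LinearMap.proj_apply]
    exact Submodule.sum_mem _ fun i _ => Submodule.mem_iSup_of_mem i (hv' i)
  · refine iSup_le fun i v hv => ?_
    refine ⟨Pi.single i v, (mem_tangent_pi M hy').2 fun j => ?_, by simp⟩
    by_cases hj : j = i
    · subst hj; simpa using hv
    · simp [hj]

/-- The generic dimension of the sum of the tangent spaces of the `M i`. -/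
noncomputable def rk (M : ι → Set V) : ℕ :=
  sSup {d | ∃ y ∈ Set.univ.pi M, Module.finrank ℂ (tangentSum M y) = d}

/-- Terracini's lemma: `zdim_image` for the addition map on the product of the `M i`, whose tangent
image is the sum of the tangent spaces. -/
theorem rk_spec [Fintype ι] [FiniteDimensional ℂ V] {M : ι → Set V}
    (hM : ∀ i, (vanishingIdeal (M i)).IsPrime) :
    zdim (sumset M) = rk M ∧ (∀ y ∈ Set.univ.pi M, Module.finrank ℂ (tangentSum M y) ≤ rk M) ∧
      ∃ y ∈ Set.univ.pi M, Module.finrank ℂ (tangentSum M y) = rk M := by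
  obtain ⟨d, hd, hle, w, hw, hwd⟩ := zdim_image (isPrime_vanishingIdeal_pi hM)
    (∑ i, LinearMap.proj (R := ℂ) (φ := fun _ : ι => V) i)
  have hle' : ∀ y ∈ Set.univ.pi M, Module.finrank ℂ (tangentSum M y) ≤ d := fun y hy => by
    rw [← map_tangent_pi M hy]
    exact hle y hy
  rw [map_tangent_pi M hw] at hwd
  have hrk : rk M = d := IsGreatest.csSup_eq ⟨⟨w, hw, hwd⟩, by
    rintro _ ⟨y, hy, rfl⟩
    exact hle' y hy⟩
  rw [hrk]
  refine ⟨?_, hle', w, hw, hwd⟩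
  rw [← hd, sumset]
  congr 2
  ext y
  simp

theorem eventually_finrank_tangentSum [Fintype ι] [FiniteDimensional ℂ V] {M : ι → Set V}
    (hM : ∀ i, (vanishingIdeal (M i)).IsPrime) :
    ∀ᶠ y in generic (Set.univ.pi M), Module.finrank ℂ (tangentSum M y) = rk M := by
  obtain ⟨-, hle, w, hw, hwd⟩ := rk_spec hM
  have hp := isPrime_vanishingIdeal_pi hM
  have h := eventually_le_finrank_map_tangent hp
    (∑ i, LinearMap.proj (R := ℂ) (φ := fun _ : ι => V) i) hw (d := rk M)
    (by rw [map_tangent_pi M hw, hwd])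
  filter_upwards [h, eventually_mem_generic hp] with y hy hyM
  rw [map_tangent_pi M hyM] at hy
  exact le_antisymm (hle y hyM) hy

/-- This lets rank conditions on several overlapping subtuples be imposed on one generic tuple.
Injectivity of `e` ensures that no point is used twice. -/
theorem eventually_finrank_tangentSum_comp {κ : Type*} [Fintype ι] [Finite κ]
    [FiniteDimensional ℂ V] {Y : κ → Set V} (hY : ∀ k, (vanishingIdeal (Y k)).IsPrime)
    {e : ι → κ} (he : Function.Injective e) :
    ∀ᶠ w in generic (Set.univ.pi Y),
      Module.finrank ℂ (tangentSum (fun i => Y (e i)) fun i => w (e i)) = rk fun i => Y (e i) :=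
  (tendsto_generic_pi_comp hY he).eventually
    (eventually_finrank_tangentSum fun i => hY (e i))

end Rank

/-! ### Exchanging the points of a tuple one at a time. -/

section Swap

variable {V ι : Type*} [AddCommGroup V] [Module ℂ V]

/-- The family `M` with one more entry `Z`. -/
def cons {α : Type*} (Z : α) (M : ι → α) : Option ι → α := fun o => o.elim Z M

theorem forall_cons {α : Type*} {p : α → Prop} {Z : α} {M : ι → α} (hZ : p Z) (hM : ∀ i, p (M i)) :
    ∀ o, p (cons Z M o) := by
  rintro (_ | i)
  · exact hZ
  · exact hM i

theorem cons_injective {α : Type*} {Z : α} {M : ι → α} (hM : Function.Injective M)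
    (hZ : ∀ i, M i ≠ Z) : Function.Injective (cons Z M) := by
  rintro (_ | i) (_ | j) h
  · rfl
  · exact (hZ j h.symm).elim
  · exact (hZ i h).elim
  · exact congrArg some (hM h)

theorem tangentSum_cons (Z : Set V) (M : ι → Set V) (y : Option ι → V) :
    tangentSum (cons Z M) y = tangent Z (y none) ⊔ tangentSum M fun i => y (some i) :=
  iSup_option _

/-- The generic dimension of the tangent space of `Z`. -/
noncomputable abbrev rk₁ (Z : Set V) : ℕ := rk fun _ : Unit => Z

theorem eventually_finrank_tangentSum_of_eq {κ : Type*} [Fintype ι] [Finite κ]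
    [FiniteDimensional ℂ V] {Y : κ → Set V} (hY : ∀ k, (vanishingIdeal (Y k)).IsPrime)
    {e : ι → κ} (he : Function.Injective e) {N : ι → Set V} (hN : ∀ i, Y (e i) = N i) :
    ∀ᶠ w in generic (Set.univ.pi Y), Module.finrank ℂ (tangentSum N fun i => w (e i)) = rk N := by
  obtain rfl : (fun i => Y (e i)) = N := funext hN
  exact eventually_finrank_tangentSum_comp hY he

theorem eventually_finrank_tangent {κ : Type*} [Finite κ]
    [FiniteDimensional ℂ V] {Y : κ → Set V} (hY : ∀ k, (vanishingIdeal (Y k)).IsPrime) (k : κ) :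
    ∀ᶠ w in generic (Set.univ.pi Y), Module.finrank ℂ (tangent (Y k) (w k)) = rk₁ (Y k) := by
  have h := eventually_finrank_tangentSum_of_eq hY (e := fun _ : Unit => k)
    (Function.injective_of_subsingleton _) (N := fun _ => Y k) fun _ => rfl
  filter_upwards [h] with w hw
  rwa [tangentSum, iSup_const] at hw

/-- The tuple of indices that takes the entries in `s` from the second copy of `ι` and the other
entries from the first. -/
def mixIndex [DecidableEq ι] (s : Finset ι) (i : ι) : ι ⊕ Option ι :=
  if i ∈ s then Sum.inr (some i) else Sum.inl i

theorem mixIndex_injective [DecidableEq ι] (s : Finset ι) :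
    Function.Injective (mixIndex s) := by
  intro i j h
  unfold mixIndex at h
  split_ifs at h <;> simp_all

theorem finrank_inf_add_finrank_sup [FiniteDimensional ℂ V] (S T : Submodule ℂ V) :
    Module.finrank ℂ ↥(S ⊓ T) + Module.finrank ℂ ↥(S ⊔ T) =
      Module.finrank ℂ S + Module.finrank ℂ T := by
  rw [add_comm, Submodule.finrank_sup_add_finrank_inf_eq]

/-- If adding one more entry to `M` does not increase the generic dimension of the intersection of
the tangent space of `Z` with the sum of the tangent spaces of `M`, then generically this
intersection does not depend on the points of `M`. -/
theorem eventually_inf_tangentSum_eq [Fintype ι] [FiniteDimensional ℂ V] {M : ι → Set V}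
    {Z : Set V} (hM : ∀ i, (vanishingIdeal (M i)).IsPrime) (hZ : (vanishingIdeal Z).IsPrime)
    (h : ∀ i, rk (cons Z (cons (M i) M)) + rk M = rk (cons Z M) + rk (cons (M i) M)) :
    ∀ᶠ w in generic (Set.univ.pi (Sum.elim M (cons Z M))),
      tangent Z (w (Sum.inr none)) ⊓ tangentSum M (fun i => w (Sum.inl i)) =
        tangent Z (w (Sum.inr none)) ⊓ tangentSum M (fun i => w (Sum.inr (some i))) := by
  classical
  have hY : ∀ c, (vanishingIdeal (Sum.elim M (cons Z M) c)).IsPrime := by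
    rintro (i | o)
    · exact hM i
    · exact forall_cons (p := fun S : Set V => (vanishingIdeal S).IsPrime) hZ hM o
  have hmix : ∀ s i, Sum.elim M (cons Z M) (mixIndex s i) = M i := by
    intro s i
    unfold mixIndex
    split_ifs <;> rfl
  have hne : ∀ s i, mixIndex s i ≠ (Sum.inr none : ι ⊕ Option ι) := by
    intro s i
    unfold mixIndex
    split_ifs <;> simp
  have hne' : ∀ s i j, i ∉ s → mixIndex s j ≠ (Sum.inr (some i) : ι ⊕ Option ι) := by
    intro s i j hi
    unfold mixIndex
    split_ifs with hj
    · rintro h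
      simp only [Sum.inr.injEq, Option.some.injEq] at h
      exact hi (h ▸ hj)
    · simp
  have hT := eventually_finrank_tangent hY (Sum.inr none)
  have hL : ∀ s, ∀ᶠ w in generic (Set.univ.pi (Sum.elim M (cons Z M))),
      Module.finrank ℂ (tangentSum M fun i => w (mixIndex s i)) = rk M := fun s =>
    eventually_finrank_tangentSum_of_eq hY (mixIndex_injective s) (hmix s)
  have hTL : ∀ s, ∀ᶠ w in generic (Set.univ.pi (Sum.elim M (cons Z M))),
      Module.finrank ℂ (tangentSum (cons Z M) fun o =>
        w (cons (Sum.inr none) (mixIndex s) o)) = rk (cons Z M) := fun s =>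
    eventually_finrank_tangentSum_of_eq hY (cons_injective (mixIndex_injective s) (hne s)) (by
        rintro (_ | i)
        · rfl
        · exact hmix s i)
  have hL' : ∀ s i, i ∉ s → ∀ᶠ w in generic (Set.univ.pi (Sum.elim M (cons Z M))),
      Module.finrank ℂ (tangentSum (cons (M i) M) fun o =>
        w (cons (Sum.inr (some i)) (mixIndex s) o)) = rk (cons (M i) M) := fun s i hi =>
    eventually_finrank_tangentSum_of_eq hY (cons_injective
      (mixIndex_injective s) fun j => hne' s i j hi) (by
        rintro (_ | i)
        · rfl
        · exact hmix s i)
  have hTL' : ∀ s i, i ∉ s → ∀ᶠ w in generic (Set.univ.pi (Sum.elim M (cons Z M))),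
      Module.finrank ℂ (tangentSum (cons Z (cons (M i) M)) fun o =>
        w (cons (Sum.inr none) (cons (Sum.inr (some i)) (mixIndex s)) o)) =
          rk (cons Z (cons (M i) M)) := fun s i hi =>
    eventually_finrank_tangentSum_of_eq hY (cons_injective
      (cons_injective (mixIndex_injective s) fun j => hne' s i j hi) (forall_cons
        (p := fun c : ι ⊕ Option ι => c ≠ Sum.inr none) (by simp) (hne s))) (by
        rintro (_ | _ | i)
        · rfl
        · rfl
        · exact hmix s i)
  filter_upwards [hT, eventually_all.2 hL, eventually_all.2 hTL,
    eventually_all.2 fun s => eventually_all.2 fun i => eventually_imp_distrib_left.2 (hL' s i),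
    eventually_all.2 fun s => eventually_all.2 fun i => eventually_imp_distrib_left.2 (hTL' s i)]
    with w hT hL hTL hL' hTL'
  have hT : Module.finrank ℂ (tangent Z (w (Sum.inr none))) = rk₁ Z := hT
  have hTL : ∀ s, Module.finrank ℂ ↥(tangent Z (w (Sum.inr none)) ⊔
      tangentSum M fun i => w (mixIndex s i)) = rk (cons Z M) := fun s => by
    have := hTL s
    rwa [tangentSum_cons] at this
  have hL' : ∀ s i, i ∉ s → Module.finrank ℂ ↥(tangent (M i) (w (Sum.inr (some i))) ⊔
      tangentSum M fun i => w (mixIndex s i)) = rk (cons (M i) M) := fun s i hi => by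
    have := hL' s i hi
    rwa [tangentSum_cons] at this
  have hTL' : ∀ s i, i ∉ s → Module.finrank ℂ ↥(tangent Z (w (Sum.inr none)) ⊔
      (tangent (M i) (w (Sum.inr (some i))) ⊔
      tangentSum M fun i => w (mixIndex s i))) = rk (cons Z (cons (M i) M)) := fun s i hi => by
    have := hTL' s i hi
    rwa [tangentSum_cons, tangentSum_cons] at this
  -- The intersections before and after exchanging the `i`-th point both lie in the one obtained by
  -- keeping the old point and adding the new one. By `h i` all three have the same dimension, so
  -- they coincide.
  have key : ∀ s : Finset ι, tangent Z (w (Sum.inr none)) ⊓ tangentSum M (fun i => w (Sum.inl i)) =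
        tangent Z (w (Sum.inr none)) ⊓ tangentSum M (fun i => w (mixIndex s i)) := by
    intro s
    induction s using Finset.induction_on with
    | empty => simp [mixIndex]
    | insert i s hi ih =>
      rw [ih]
      have e1 := finrank_inf_add_finrank_sup (tangent Z (w (Sum.inr none)))
        (tangentSum M fun j => w (mixIndex s j))
      have e2 := finrank_inf_add_finrank_sup (tangent Z (w (Sum.inr none)))
        (tangentSum M fun j => w (mixIndex (insert i s) j))
      have e3 := finrank_inf_add_finrank_sup (tangent Z (w (Sum.inr none)))
        (tangent (M i) (w (Sum.inr (some i))) ⊔ tangentSum M fun j => w (mixIndex s j))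
      rw [hT, hTL, hL] at e1 e2
      rw [hT, hTL' s i hi, hL' s i hi] at e3
      have e4 := h i
      have hle : tangentSum M (fun j => w (mixIndex (insert i s) j)) ≤
          tangent (M i) (w (Sum.inr (some i))) ⊔ tangentSum M fun j => w (mixIndex s j) := by
        refine iSup_le fun j => ?_
        by_cases hj : j = i
        · subst hj
          simp [mixIndex]
        · refine le_trans (le_of_eq ?_)
            (le_trans (le_iSup (fun j => tangent (M j) (w (mixIndex s j))) j) le_sup_right)
          simp [mixIndex, hj]
      refine (Submodule.eq_of_le_of_finrank_eq (inf_le_inf_left _ (le_sup_right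
        (a := tangent (M i) (w (Sum.inr (some i)))))) ?_).trans
        (Submodule.eq_of_le_of_finrank_eq (inf_le_inf_left _ hle) ?_).symm
      · omega
      · omega
  rw [key Finset.univ]
  simp [mixIndex]

end Swap

/-! ### Group action and irreducibility. -/

section Invariance

variable {G V ι : Type*} [Group G] [AddCommGroup V] [Module ℂ V] {ρ : Representation ℂ G V}

/-- The action of a group element as a linear automorphism. -/
def actEquiv (ρ : Representation ℂ G V) (g : G) : V ≃ₗ[ℂ] V :=
  LinearEquiv.ofLinearMap (ρ g) (ρ g⁻¹)
    (by rw [← Module.End.mul_eq_comp, ← map_mul, mul_inv_cancel, map_one]; rfl)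
    (by rw [← Module.End.mul_eq_comp, ← map_mul, inv_mul_cancel, map_one]; rfl)

/-- `Y` is stable under the action of the group. -/
def IsStable (ρ : Representation ℂ G V) (Y : Set V) : Prop := ∀ g, ∀ v ∈ Y, ρ g v ∈ Y

theorem IsStable.mem_iff {Y : Set V} (hY : IsStable ρ Y) (g : G) (v : V) :
    actEquiv ρ g v ∈ Y ↔ v ∈ Y := by
  refine ⟨fun h => ?_, hY g v⟩
  have := hY g⁻¹ _ h
  rwa [show ρ g⁻¹ (actEquiv ρ g v) = v from (actEquiv ρ g).symm_apply_apply v] at this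

theorem IsStable.tangent_apply {Y : Set V} (hY : IsStable ρ Y) (g : G) (v : V) :
    tangent Y (actEquiv ρ g v) = (tangent Y v).map (actEquiv ρ g : V →ₗ[ℂ] V) :=
  SecantCones.tangent_apply _ (hY.mem_iff g) v

theorem tangentSum_apply {M : ι → Set V} (hM : ∀ i, IsStable ρ (M i)) (g : G) (y : ι → V) :
    tangentSum M (fun i => actEquiv ρ g (y i)) =
      (tangentSum M y).map (actEquiv ρ g : V →ₗ[ℂ] V) := by
  rw [tangentSum, tangentSum, Submodule.map_iSup]
  exact iSup_congr fun i => (hM i).tangent_apply g (y i)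

theorem tendsto_generic_act [Finite ι] {M : ι → Set V} (hM : ∀ i, IsStable ρ (M i))
    (hp : ∀ i, (vanishingIdeal (M i)).IsPrime) (g : G) :
    Tendsto (fun y : ι → V => fun i => actEquiv ρ g (y i)) (generic (Set.univ.pi M))
      (generic (Set.univ.pi M)) := by
  refine tendsto_generic (isPrime_vanishingIdeal_pi hp) (isPrime_vanishingIdeal_pi hp)
    (IsPolyMap.pi (F := fun i (y : ι → V) => actEquiv ρ g (y i)) fun i =>
      isPolyMap_linear ((actEquiv ρ g : V →ₗ[ℂ] V) ∘ₗ
        LinearMap.proj (R := ℂ) (φ := fun _ : ι => V) i)) ?_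
  ext y
  constructor
  · rintro ⟨z, hz, rfl⟩ i _
    exact ((hM i).mem_iff g _).2 (hz i trivial)
  · intro hy
    refine ⟨fun i => (actEquiv ρ g).symm (y i), fun i _ => ?_, funext fun i => by simp⟩
    rw [← (hM i).mem_iff g]
    simpa using hy i trivial

/-- A stable linear subspace of an irreducible representation is trivial. -/
theorem eq_bot_or_eq_top_of_stable (hρ : ρ.IsIrreducible) (S : Submodule ℂ V)
    (hS : ∀ g, ∀ v ∈ S, ρ g v ∈ S) : S = ⊥ ∨ S = ⊤ := by
  have := hρ
  rcases eq_bot_or_eq_top (⟨S, hS⟩ : Subrepresentation ρ) with h | h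
  · exact Or.inl (congrArg Subrepresentation.toSubmodule h)
  · exact Or.inr (congrArg Subrepresentation.toSubmodule h)

/-- If the tangent space of `Z` meets the sum of the tangent spaces of `M` nontrivially, and the
dimension of the intersection does not grow when an entry of `M` is repeated, then the sum of the
tangent spaces of `M` is the whole space. -/
theorem rk_eq_finrank [Fintype ι] [FiniteDimensional ℂ V] (hρ : ρ.IsIrreducible) {M : ι → Set V}
    {Z : Set V} (hM : ∀ i, (vanishingIdeal (M i)).IsPrime) (hZ : (vanishingIdeal Z).IsPrime)
    (hMs : ∀ i, IsStable ρ (M i)) (hZs : IsStable ρ Z)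
    (h : ∀ i, rk (cons Z (cons (M i) M)) + rk M = rk (cons Z M) + rk (cons (M i) M))
    (hpos : rk (cons Z M) < rk₁ Z + rk M) : rk M = Module.finrank ℂ V := by
  have hZM := forall_cons (p := fun S : Set V => (vanishingIdeal S).IsPrime) hZ hM
  have hZMs := forall_cons (p := IsStable ρ) hZs hMs
  -- A tuple is good if it cuts the same subspace from a generic tangent space of `Z` as a generic
  -- tuple does. This condition is invariant under the group.
  let good : Set (ι → V) := {y | y ∈ Set.univ.pi M ∧
    ∀ᶠ w in generic (Set.univ.pi (cons Z M)),
      tangent Z (w none) ⊓ tangentSum M y = tangent Z (w none) ⊓ tangentSum M fun i => w (some i)}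
  have hgood : good.Nonempty := by
    have h1 := eventually_generic_sum hM hZM (eventually_inf_tangentSum_eq hM hZ h)
    have := generic_neBot (isPrime_vanishingIdeal_pi hM)
    obtain ⟨y, hy, hyM⟩ :=
      (h1.and (eventually_mem_generic (isPrime_vanishingIdeal_pi hM))).exists
    exact ⟨y, hyM, hy⟩
  have hgood_act : ∀ g, ∀ y ∈ good, (fun i => actEquiv ρ g (y i)) ∈ good := by
    rintro g y ⟨hyM, hy⟩
    refine ⟨fun i hi => ((hMs i).mem_iff g _).2 (hyM i hi), ?_⟩
    filter_upwards [(tendsto_generic_act hZMs hZM g⁻¹).eventually hy] with w hw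
    have hinv : ∀ v, actEquiv ρ g (actEquiv ρ g⁻¹ v) = v := fun v =>
      (actEquiv ρ g).apply_symm_apply v
    have h2 := congrArg (Submodule.map (actEquiv ρ g : V →ₗ[ℂ] V)) hw
    rw [Submodule.map_inf _ (actEquiv ρ g).injective, Submodule.map_inf _ (actEquiv ρ g).injective,
      ← hZs.tangent_apply, ← tangentSum_apply hMs, ← tangentSum_apply hMs] at h2
    simpa only [hinv] using h2
  let S : Submodule ℂ V := ⨅ y : good, tangentSum M y
  have hS : ∀ g, ∀ v ∈ S, ρ g v ∈ S := by
    intro g v hv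
    rw [Submodule.mem_iInf] at hv ⊢
    rintro ⟨y, hy⟩
    have hm := Submodule.mem_map_of_mem (f := (actEquiv ρ g : V →ₗ[ℂ] V))
      (hv ⟨_, hgood_act g⁻¹ y hy⟩)
    rw [← tangentSum_apply hMs] at hm
    have hinv : ∀ v, actEquiv ρ g (actEquiv ρ g⁻¹ v) = v := fun v =>
      (actEquiv ρ g).apply_symm_apply v
    simp only [hinv] at hm
    exact hm
  have hSbot : S ≠ ⊥ := by
    -- A single `w` can be generic with respect to finitely many good tuples only. By finite
    -- dimension, finitely many already compute `S`, so `S` contains `T Z ∩ L` at `w`, which is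
    -- nonzero by `hpos`.
    obtain ⟨s, hs⟩ := Finset.exists_inf_le fun y : good => tangentSum M y
    have h1 : ∀ᶠ w in generic (Set.univ.pi (cons Z M)), ∀ y ∈ s,
        tangent Z (w none) ⊓ tangentSum M y =
          tangent Z (w none) ⊓ tangentSum M fun i => w (some i) :=
      (eventually_all_finset s).2 fun y _ => y.2.2
    have := generic_neBot (isPrime_vanishingIdeal_pi hZM)
    obtain ⟨w, hw, hT, hL, hTL⟩ := (h1.and ((eventually_finrank_tangent hZM none).and
      ((eventually_finrank_tangentSum_of_eq hZM (Option.some_injective ι) (N := M)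
        fun _ => rfl).and (eventually_finrank_tangentSum hZM)))).exists
    have hT : Module.finrank ℂ (tangent Z (w none)) = rk₁ Z := hT
    rw [tangentSum_cons] at hTL
    have e1 := finrank_inf_add_finrank_sup (tangent Z (w none))
        (tangentSum M fun j => w (some j))
    have hle : tangent Z (w none) ⊓ (tangentSum M fun i => w (some i)) ≤ S := by
      refine le_iInf fun y => le_trans ?_ (hs y)
      refine Finset.le_inf fun y hy => ?_
      rw [← hw y hy]
      exact inf_le_right
    intro hS
    rw [hS, le_bot_iff] at hle
    rw [hle, finrank_bot, hT, hL, hTL] at e1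
    omega
  obtain ⟨-, hle, -⟩ := rk_spec hM
  obtain ⟨y, hy⟩ := hgood
  have hStop := (eq_bot_or_eq_top_of_stable hρ S hS).resolve_left hSbot
  have hytop : tangentSum M y = ⊤ := top_le_iff.1 (hStop ▸ iInf_le _ (⟨y, hy⟩ : good))
  have h1 := hle y hy.1
  rw [hytop, finrank_top] at h1
  refine le_antisymm ?_ h1
  obtain ⟨-, -, y', -, hy'⟩ := rk_spec hM
  rw [← hy']
  exact Submodule.finrank_le _

end Invariance

/-! ### Monotonicity, subadditivity and submodularity of the generic rank. -/

section RankInequalities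

variable {V ι : Type*} [AddCommGroup V] [Module ℂ V] [FiniteDimensional ℂ V] [Fintype ι]

theorem rk_le_finrank {M : ι → Set V} (hM : ∀ i, (vanishingIdeal (M i)).IsPrime) :
    rk M ≤ Module.finrank ℂ V := by
  obtain ⟨-, -, y, -, hy⟩ := rk_spec hM
  rw [← hy]
  exact Submodule.finrank_le _

theorem rk_comp_le {κ : Type*} [Fintype κ] {M : ι → Set V}
    (hM : ∀ i, (vanishingIdeal (M i)).IsPrime) {e : κ → ι} (he : Function.Injective e) :
    rk (fun k => M (e k)) ≤ rk M := by
  have := generic_neBot (isPrime_vanishingIdeal_pi hM)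
  obtain ⟨w, hw, hw'⟩ := ((eventually_finrank_tangentSum_comp hM he).and
    (eventually_finrank_tangentSum hM)).exists
  rw [← hw, ← hw']
  exact Submodule.finrank_mono (iSup_le fun k => le_iSup (fun i => tangent (M i) (w i)) (e k))

theorem rk_comp_equiv {κ : Type*} [Fintype κ] {M : ι → Set V}
    (hM : ∀ i, (vanishingIdeal (M i)).IsPrime) (e : κ ≃ ι) : rk (fun k => M (e k)) = rk M := by
  refine le_antisymm (rk_comp_le hM e.injective) ?_
  have h := rk_comp_le (fun k => hM (e k)) e.symm.injective
  simpa using h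

theorem rk_le_sum {M : ι → Set V} (hM : ∀ i, (vanishingIdeal (M i)).IsPrime) :
    rk M ≤ ∑ i, rk₁ (M i) := by
  classical
  have := generic_neBot (isPrime_vanishingIdeal_pi hM)
  obtain ⟨w, hw, hw'⟩ := ((eventually_finrank_tangentSum hM).and
    (eventually_all.2 fun i => eventually_finrank_tangent hM i)).exists
  rw [← hw, Finset.sum_congr rfl fun i _ => (hw' i).symm, tangentSum]
  have h : ∀ s : Finset ι, Module.finrank ℂ ↥(⨆ i ∈ s, tangent (M i) (w i)) ≤
      ∑ i ∈ s, Module.finrank ℂ (tangent (M i) (w i)) := by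
    intro s
    induction s using Finset.induction_on with
    | empty => simp
    | insert i s hi ih =>
      rw [Finset.iSup_insert, Finset.sum_insert hi]
      exact (Submodule.finrank_add_le_finrank_add_finrank _ _).trans (by omega)
  refine le_trans (Submodule.finrank_mono (iSup_le fun i => ?_)) (h Finset.univ)
  exact le_iSup₂ (f := fun i (_ : i ∈ Finset.univ) => tangent (M i) (w i)) i (Finset.mem_univ i)

theorem rk_le_rk_cons {M : ι → Set V} {Z : Set V} (hM : ∀ i, (vanishingIdeal (M i)).IsPrime)
    (hZ : (vanishingIdeal Z).IsPrime) : rk M ≤ rk (cons Z M) :=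
  rk_comp_le (forall_cons (p := fun S : Set V => (vanishingIdeal S).IsPrime) hZ hM)
    (Option.some_injective ι)

/-- At one generic tuple, the intersection of the tangent space of `Z` with the sum for `M` can only
grow when a tangent space of `Y` is added to that sum. -/
theorem rk_submodular {M : ι → Set V} {Y Z : Set V} (hM : ∀ i, (vanishingIdeal (M i)).IsPrime)
    (hY : (vanishingIdeal Y).IsPrime) (hZ : (vanishingIdeal Z).IsPrime) :
    rk (cons Z (cons Y M)) + rk M ≤ rk (cons Z M) + rk (cons Y M) := by
  have hYM := forall_cons (p := fun S : Set V => (vanishingIdeal S).IsPrime) hY hM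
  have hZYM := forall_cons (p := fun S : Set V => (vanishingIdeal S).IsPrime) hZ hYM
  have := generic_neBot (isPrime_vanishingIdeal_pi hZYM)
  obtain ⟨w, hT, hL, hTL, hYL, hTYL⟩ := ((eventually_finrank_tangent hZYM none).and
    ((eventually_finrank_tangentSum_of_eq hZYM (e := fun i => some (some i))
      (fun i j h => Option.some_injective _ (Option.some_injective _ h)) (N := M)
      fun _ => rfl).and
    ((eventually_finrank_tangentSum_of_eq hZYM (e := cons none fun i => some (some i))
      (cons_injective (fun i j h => Option.some_injective _ (Option.some_injective _ h)) (by simp))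
      (N := cons Z M) (by rintro (_ | i) <;> rfl)).and
    ((eventually_finrank_tangentSum_of_eq hZYM (Option.some_injective _) (N := cons Y M)
      fun _ => rfl).and (eventually_finrank_tangentSum hZYM))))).exists
  have hT : Module.finrank ℂ (tangent Z (w none)) = rk₁ Z := hT
  rw [tangentSum_cons] at hTL hYL hTYL
  rw [tangentSum_cons] at hTYL
  have hTL : Module.finrank ℂ ↥(tangent Z (w none) ⊔ tangentSum M fun i => w (some (some i))) =
    rk (cons Z M) := hTL
  have e1 := finrank_inf_add_finrank_sup (tangent Z (w none))
    (tangentSum M fun i => w (some (some i)))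
  have e2 := finrank_inf_add_finrank_sup (tangent Z (w none))
    (tangent Y (w (some none)) ⊔ tangentSum M fun i => w (some (some i)))
  have e3 := Submodule.finrank_mono (inf_le_inf_left (tangent Z (w none))
    (le_sup_right (a := tangent Y (w (some none)))
      (b := tangentSum M fun i => w (some (some i)))))
  omega

theorem zdim_eq_rk₁ {Z : Set V} (hZ : (vanishingIdeal Z).IsPrime) : zdim Z = rk₁ Z := by
  rw [← (rk_spec fun _ : Unit => hZ).1]
  congr 1
  ext v
  constructor
  · intro hv
    exact ⟨fun _ => v, fun _ _ => hv, by simp⟩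
  · rintro ⟨y, hy, rfl⟩
    simpa using hy () trivial

end RankInequalities

/-! ### Growth of the excess and the numerical bounds. -/

section Growth

variable {G V : Type*} [Group G] [AddCommGroup V] [Module ℂ V] [FiniteDimensional ℂ V]
  {ρ : Representation ℂ G V}

/-- The last inequality says that the excess of `Z` over `L` is larger than `j`. While `L` does not
fill `V`, `rk_eq_finrank` provides an entry whose repetition changes the excess, and submodularity
makes the change an increase. -/
theorem exists_rk_cons_growth (hρ : ρ.IsIrreducible) {C : Set (Set V)}
    (hC : ∀ Y ∈ C, (vanishingIdeal Y).IsPrime) (hCs : ∀ Y ∈ C, IsStable ρ Y) {s : ℕ}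
    {M : Fin s → Set V} {Z : Set V} (hM : ∀ i, M i ∈ C) (hZ : Z ∈ C)
    (hpos : rk (cons Z M) < rk₁ Z + rk M) (j : ℕ) :
    ∃ (κ : Type) (_ : Fintype κ) (L : κ → Set V), (∀ k, L k ∈ C) ∧ Fintype.card κ ≤ s + j ∧
      (rk L = Module.finrank ℂ V ∨ rk (cons Z L) + j < rk₁ Z + rk L) := by
  induction j with
  | zero => exact ⟨Fin s, inferInstance, M, hM, by simp, Or.inr hpos⟩
  | succ j ih =>
    obtain ⟨κ, _, L, hL, hcard, h⟩ := ih
    by_cases hfull : rk L = Module.finrank ℂ V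
    · exact ⟨κ, inferInstance, L, hL, by omega, Or.inl hfull⟩
    have h := h.resolve_left hfull
    obtain ⟨k, hk⟩ : ∃ k, rk (cons Z (cons (L k) L)) + rk L ≠
        rk (cons Z L) + rk (cons (L k) L) := by
      by_contra! hcon
      exact hfull (rk_eq_finrank hρ (fun k => hC _ (hL k)) (hC Z hZ) (fun k => hCs _ (hL k))
        (hCs Z hZ) hcon (by omega))
    have hsub := rk_submodular (fun k => hC _ (hL k)) (hC _ (hL k)) (hC Z hZ)
    refine ⟨Option κ, inferInstance, cons (L k) L,
      forall_cons (p := fun S => S ∈ C) (hL k) hL, by rw [Fintype.card_option]; omega, Or.inr ?_⟩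
    omega

/-- Once the tangent spaces of `Z` and of the `M i` are dependent, at most `dim Z` further entries
are needed to fill the ambient space. -/
theorem exists_rk_eq_finrank (hρ : ρ.IsIrreducible) {C : Set (Set V)}
    (hC : ∀ Y ∈ C, (vanishingIdeal Y).IsPrime) (hCs : ∀ Y ∈ C, IsStable ρ Y) {s : ℕ}
    {M : Fin s → Set V} {Z : Set V} (hM : ∀ i, M i ∈ C) (hZ : Z ∈ C)
    (hpos : rk (cons Z M) < rk₁ Z + rk M) :
    ∃ (κ : Type) (_ : Fintype κ) (L : κ → Set V), (∀ k, L k ∈ C) ∧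
      Fintype.card κ ≤ s + rk₁ Z ∧ rk L = Module.finrank ℂ V := by
  obtain ⟨κ, _, L, hL, hcard, h⟩ := exists_rk_cons_growth hρ hC hCs hM hZ hpos (rk₁ Z)
  -- An excess above `rk₁ Z` would contradict `rk L ≤ rk (cons Z L)`.
  refine ⟨κ, inferInstance, L, hL, hcard, h.resolve_right fun h => ?_⟩
  have := rk_le_rk_cons (fun k => hC _ (hL k)) (hC Z hZ)
  omega

theorem rk_fin_succ {s : ℕ} {Y : Fin (s + 1) → Set V}
    (hY : ∀ i, (vanishingIdeal (Y i)).IsPrime) :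
    rk Y = rk (cons (Y 0) fun i : Fin s => Y i.succ) := by
  rw [← rk_comp_equiv hY (finSuccEquiv s).symm]
  congr 1
  ext (_ | i) <;> simp [cons]

/-- Either the tangent spaces of `Y` are generically independent, or a shorter tuple with one more
entry is generically dependent. -/
theorem rk_eq_sum_or_exists {C : Set (Set V)} (hC : ∀ Y ∈ C, (vanishingIdeal Y).IsPrime) {r : ℕ}
    (Y : Fin r → Set V) (hY : ∀ i, Y i ∈ C) :
    rk Y = ∑ i, rk₁ (Y i) ∨ ∃ s < r, ∃ M : Fin s → Set V, ∃ Z ∈ C, (∀ i, M i ∈ C) ∧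
      rk M = ∑ i, rk₁ (M i) ∧ rk (cons Z M) < rk₁ Z + rk M := by
  induction r with
  | zero =>
    left
    have := rk_le_sum fun i => hC _ (hY i)
    simpa using this
  | succ r ih =>
    rcases ih (fun i => Y i.succ) fun i => hY _ with h | ⟨s, hs, h⟩
    · by_cases hlt : rk Y < rk₁ (Y 0) + rk fun i : Fin r => Y i.succ
      · rw [rk_fin_succ fun i => hC _ (hY i)] at hlt
        exact Or.inr ⟨r, r.lt_succ_self, _, Y 0, hY 0, fun i => hY _, h, hlt⟩
      · left
        have hle := rk_le_sum fun i => hC _ (hY i)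
        rw [Fin.sum_univ_succ] at hle ⊢
        omega
    · exact Or.inr ⟨s, by omega, h⟩

/-- A dependence among the `r` entries would let at most `s + N < r + N` entries of dimension at
most `N` fill `V`, against `hr`. -/
theorem rk_eq_sum_of_le (hρ : ρ.IsIrreducible) {C : Set (Set V)}
    (hC : ∀ Y ∈ C, (vanishingIdeal Y).IsPrime) (hCs : ∀ Y ∈ C, IsStable ρ Y) {N r : ℕ}
    (hN0 : 0 < N) (hN : ∀ Y ∈ C, rk₁ Y ≤ N) (hr : N * (r + N) ≤ Module.finrank ℂ V)
    (Y : Fin r → Set V) (hY : ∀ i, Y i ∈ C) : rk Y = ∑ i, rk₁ (Y i) := by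
  refine (rk_eq_sum_or_exists hC Y hY).resolve_right ?_
  rintro ⟨s, hs, M, Z, hZ, hM, -, hlt⟩
  obtain ⟨κ, _, L, hL, hcard, hLV⟩ := exists_rk_eq_finrank hρ hC hCs hM hZ hlt
  have h1 := rk_le_sum fun k => hC _ (hL k)
  have h2 : ∑ k, rk₁ (L k) ≤ Fintype.card κ * N := by
    have := Finset.sum_le_card_nsmul Finset.univ (fun k => rk₁ (L k)) N fun k _ => hN _ (hL k)
    simpa using this
  have h3 := hN Z hZ
  have h4 : Fintype.card κ * N < (r + N) * N := Nat.mul_lt_mul_of_pos_right (by omega) hN0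
  rw [mul_comm] at hr
  omega

theorem rk_const_eq_finrank (hρ : ρ.IsIrreducible) {Z : Set V}
    (hZ : (vanishingIdeal Z).IsPrime) (hZs : IsStable ρ Z) {r : ℕ} (h0 : 0 < rk₁ Z)
    (hr : Module.finrank ℂ V + rk₁ Z * rk₁ Z ≤ rk₁ Z * r) :
    (rk fun _ : Fin r => Z) = Module.finrank ℂ V := by
  have hC : ∀ Y ∈ ({Z} : Set (Set V)), (vanishingIdeal Y).IsPrime := by
    rintro _ rfl; exact hZ
  have hCs : ∀ Y ∈ ({Z} : Set (Set V)), IsStable ρ Y := by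
    rintro _ rfl; exact hZs
  -- More than `dim V` copies of a positive-dimensional `Z` cannot be independent. So some `s`
  -- independent copies, with `s * rk₁ Z ≤ dim V`, become dependent when one more is added.
  rcases rk_eq_sum_or_exists hC (fun _ : Fin (Module.finrank ℂ V + 1) => Z) (fun _ => rfl) with
    h | ⟨s, -, M, Z', hZ', hM, hsum, hlt⟩
  · have h1 := rk_le_finrank fun _ : Fin (Module.finrank ℂ V + 1) => hZ
    rw [h] at h1
    simp only [Finset.sum_const, Finset.card_univ, Fintype.card_fin, smul_eq_mul] at h1
    nlinarith
  · obtain rfl : Z' = Z := hZ'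
    obtain rfl : M = fun _ => Z' := funext hM
    obtain ⟨κ, _, L, hL, hcard, hLV⟩ := exists_rk_eq_finrank hρ hC hCs hM rfl hlt
    obtain rfl : L = fun _ => Z' := funext hL
    have h1 := rk_le_finrank fun _ : Fin s => hZ
    rw [hsum] at h1
    simp only [Finset.sum_const, Finset.card_univ, Fintype.card_fin, smul_eq_mul] at h1
    have hκ : Fintype.card κ ≤ Fintype.card (Fin r) := by
      rw [Fintype.card_fin]
      by_contra! hcon
      nlinarith
    obtain ⟨e⟩ := Function.Embedding.nonempty_of_card_le hκ
    refine le_antisymm (rk_le_finrank fun _ => hZ) ?_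
    rw [← hLV]
    exact rk_comp_le (fun _ => hZ) e.injective

end Growth

/-! ### Zariski closures and sets of full dimension. -/

section Zariski

variable {V : Type*} [AddCommGroup V] [Module ℂ V]

theorem isZariskiClosed_setOf_eq_zero (f : polyFun V) :
    IsZariskiClosed {v | (f : V → ℂ) v = 0} := by
  refine (@isOpen_compl_iff V _ (zariskiTopology V)).1 ?_
  change _ᶜᶜ ∈ {Z : Set V | ∃ S : Set (polyFun V), Z = zeroSet S}
  exact ⟨{f}, by ext v; simp [zeroSet]⟩

theorem vanishingIdeal_zariskiClosure (S : Set V) :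
    vanishingIdeal (zariskiClosure S) = vanishingIdeal S := by
  ext f
  constructor
  · exact fun h v hv => h v (@subset_closure V (zariskiTopology V) S v hv)
  · exact fun h v hv => @closure_minimal V (zariskiTopology V) _ _ h
      (isZariskiClosed_setOf_eq_zero f) v hv

theorem zdim_zariskiClosure (S : Set V) : zdim (zariskiClosure S) = zdim S := by
  rw [zdim, zdim, vanishingIdeal_zariskiClosure]

theorem isPrime_vanishingIdeal_of_isIrreducible {Z : Set V}
    (hZ : @IsIrreducible V (zariskiTopology V) Z) : (vanishingIdeal Z).IsPrime := by
  refine isPrime_vanishingIdeal_of_common hZ.1 fun f g hf hg hfZ hgZ => ?_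
  have hopen : ∀ h : polyFun V, @IsOpen V (zariskiTopology V) {v | (h : V → ℂ) v ≠ 0} := fun h =>
    (@isOpen_compl_iff V _ (zariskiTopology V)).2 (isZariskiClosed_setOf_eq_zero h)
  exact hZ.2 _ _ (hopen ⟨f, hf⟩) (hopen ⟨g, hg⟩) hfZ hgZ

/-- The polynomial functions on a finite-dimensional space form a polynomial ring. -/
noncomputable def polyFunEquiv [FiniteDimensional ℂ V] :
    MvPolynomial (Fin (Module.finrank ℂ V)) ℂ ≃ₐ[ℂ] polyFun V :=
  AlgEquiv.ofBijective
    (MvPolynomial.aeval fun i => linForm ((Module.finBasis ℂ V).coord i)) (by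
      constructor
      · rw [injective_iff_map_eq_zero]
        intro p hp
        refine MvPolynomial.funext fun x => ?_
        let v := (Module.finBasis ℂ V).equivFun.symm x
        have h : ∀ q : MvPolynomial (Fin (Module.finrank ℂ V)) ℂ,
            ((MvPolynomial.aeval (fun i => linForm ((Module.finBasis ℂ V).coord i)) q :
              polyFun V) : V → ℂ) v = MvPolynomial.eval x q := by
          intro q
          induction q using MvPolynomial.induction_on with
          | C c => simp
          | add p q hp hq => simp [hp, hq]
          | mul_X p i hp =>
            rw [map_mul, map_mul, ← hp, MvPolynomial.aeval_X, MvPolynomial.eval_X]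
            refine congrArg (fun c : ℂ => _ * c) ?_
            exact congrFun ((Module.finBasis ℂ V).equivFun.apply_symm_apply x) i
        rw [← h, hp]
        simp
      · rw [← AlgHom.range_eq_top, ← Algebra.adjoin_range_eq_range_aeval]
        exact adjoin_coord_eq_top _)

theorem ringKrullDim_quotient_add_one_le {R : Type*} [CommRing R] [IsDomain R] {I : Ideal R} {f : R}
    (hf : f ∈ I) (hne : f ≠ 0) : ringKrullDim (R ⧸ I) + 1 ≤ ringKrullDim R := by
  have h := (Ideal.span_singleton_le_iff_mem _).2 hf
  exact (add_le_add_left (ringKrullDim_le_of_surjective (Ideal.Quotient.factor h)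
    (Ideal.Quotient.factor_surjective h)) 1).trans
    (ringKrullDim_quotient_succ_le_of_nonZeroDivisor (mem_nonZeroDivisors_of_ne_zero hne))

/-- `ℂ[V]` is a domain of dimension `dim V`, and a nonzero function vanishing on `S` would lower the
dimension of the quotient by at least one. -/
theorem eq_univ_of_zdim_eq_finrank [FiniteDimensional ℂ V] {S : Set V}
    (hS : zdim S = Module.finrank ℂ V) : zariskiClosure S = Set.univ := by
  have hdom : IsDomain (polyFun V) := polyFunEquiv.symm.toMulEquiv.isDomain _
  have hdim : ringKrullDim (polyFun V) = Module.finrank ℂ V := by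
    rw [← ringKrullDim_eq_of_ringEquiv polyFunEquiv.toRingEquiv,
      MvPolynomial.ringKrullDim_of_isNoetherianRing]
    simp
  have hbot : ∀ f ∈ vanishingIdeal S, f = 0 := by
    intro f hf
    by_contra hne
    have h3 : zdim S + 1 ≤ Module.finrank ℂ V := by
      rw [← hdim]
      exact ringKrullDim_quotient_add_one_le hf hne
    rw [hS] at h3
    have h4 : Module.finrank ℂ V + 1 ≤ Module.finrank ℂ V := by exact_mod_cast h3
    omega
  obtain ⟨T, hT⟩ : zariskiClosure S ∈ {Z : Set V | ∃ S : Set (polyFun V), Z = zeroSet S} := by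
    have h := (@isOpen_compl_iff V _ (zariskiTopology V)).2
      (@isClosed_closure V (zariskiTopology V) S)
    have h' : (zariskiClosure S)ᶜᶜ ∈ {Z : Set V | ∃ S : Set (polyFun V), Z = zeroSet S} := h
    rwa [compl_compl] at h'
  rw [hT, Set.eq_univ_iff_forall]
  intro v f hf
  have : f ∈ vanishingIdeal S := by
    rw [← vanishingIdeal_zariskiClosure, hT]
    exact fun w hw => hw f hf
  rw [hbot f this]
  rfl

theorem join_eq {r : ℕ} (Y : Fin r → Set V) : join Y = zariskiClosure (sumset Y) := by
  rw [join, sumset]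
  congr 1
  ext v
  simp [Set.mem_pi, eq_comm]

end Zariski

end SecantCones

/-! ### The main theorem. -/

theorem mainTheorem3 {G V : Type*} [Group G] [AddCommGroup V] [Module ℂ V]
    [FiniteDimensional ℂ V] (ρ : Representation ℂ G V) (hρ : ρ.IsIrreducible)
    (X : Set V) (hX : SecantCones.IsAffineCone X)
    (hGX : ∀ g : G, ∀ v ∈ X, ρ g v ∈ X)
    (hGcomp : ∀ g : G, ∀ Z ∈ SecantCones.components X, ∀ v ∈ Z, ρ g v ∈ Z)
    (N : ℕ) (hN : IsGreatest (SecantCones.zdim '' SecantCones.components X) (N : WithBot ℕ∞))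
    (hN0 : 0 < N) (r : ℕ) :
    ((r : ℝ) ≤ (Module.finrank ℂ V : ℝ) / N - N → SecantCones.IsNondefective r X) ∧
    ((Module.finrank ℂ V : ℝ) / N + N ≤ (r : ℝ) → SecantCones.secant r X = Set.univ) := by
  open SecantCones in
  have hN0' : (0 : ℝ) < N := by exact_mod_cast hN0
  have hC : ∀ Y ∈ components X, (vanishingIdeal Y).IsPrime := fun Y hY =>
    isPrime_vanishingIdeal_of_isIrreducible hY.1.1
  have hCs : ∀ Y ∈ components X, IsStable ρ Y := fun Y hY g => hGcomp g Y hY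
  have hle : ∀ Y ∈ components X, rk₁ Y ≤ N := fun Y hY => by
    have h := hN.2 ⟨Y, hY, rfl⟩
    rw [zdim_eq_rk₁ (hC Y hY)] at h
    exact_mod_cast h
  refine ⟨fun hr Y hY => ?_, fun hr => ?_⟩
  · have hr' : N * (r + N) ≤ Module.finrank ℂ V := by
      rw [le_sub_iff_add_le, le_div_iff₀ hN0'] at hr
      rw [mul_comm]
      exact_mod_cast hr
    have h := rk_eq_sum_of_le hρ hC hCs hN0 hle hr' Y hY
    have hp : ∀ i, (vanishingIdeal (Y i)).IsPrime := fun i => hC _ (hY i)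
    -- Once the rank is the sum of the dimensions, this bound shows that the minimum in
    -- `expectedDim` is that sum.
    have h1 := rk_le_finrank hp
    rw [join_eq, zdim_zariskiClosure, (rk_spec hp).1, expectedDim,
      Finset.sum_congr rfl fun i _ => zdim_eq_rk₁ (hp i), ← Nat.cast_sum, ← h, min_eq_left]
    exact_mod_cast h1
  -- A single component of maximal dimension suffices: its own `r`-th secant variety is already `V`.
  · obtain ⟨⟨Z, hZ, hZN⟩, -⟩ := hN
    have hZN' : rk₁ Z = N := by
      rw [zdim_eq_rk₁ (hC Z hZ)] at hZN
      exact_mod_cast hZN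
    have hr' : Module.finrank ℂ V + N * N ≤ N * r := by
      have h1 : (Module.finrank ℂ V : ℝ) + N * N ≤ N * r := by
        have h2 := mul_le_mul_of_nonneg_left hr hN0'.le
        rwa [mul_add, mul_div_cancel₀ _ hN0'.ne'] at h2
      exact_mod_cast h1
    have h := rk_const_eq_finrank hρ (hC Z hZ) (hCs Z hZ) (r := r) (by omega) (by rwa [hZN'])
    have h1 : zariskiClosure (sumset fun _ : Fin r => Z) = Set.univ :=
      eq_univ_of_zdim_eq_finrank (by rw [(rk_spec fun _ => hC Z hZ).1, h])
    rw [secant, join_eq, ← Set.univ_subset_iff, ← h1]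
    exact @closure_mono V (zariskiTopology V) _ _
      (Set.image_mono (Set.pi_mono fun _ _ => hZ.1.2))
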